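/- Let $\Omega\subseteq\mathbb R^p$ be nonempty, closed and convex. For $x,w\in\mathbb R^p$, $\gamma>0$ put $\psi(x,w,\gamma)=\arg\min_{\theta\in\Omega}\langle w,\theta\rangle+\frac1{2\gamma}\|\theta-x\|^2$ and $g(\theta,w,\gamma)=\frac1\gamma(\theta-\psi(\theta,w,\gamma))$, and assume $\|\psi(x,w,\gamma)\|\le M$ for all $x\in\Omega$, $w\in\mathbb R^p$, $\gamma>0$. Let $F$ be a real function that is differentiable at the points of $\Omega$, and let $L>0$, $l\ge 0$ be such that, for all $x,y\in\Omega$, $\|\nabla F(x)-\nabla F(y)\|\le L\|x-y\|$ and $-\frac l2\|x-y\|^2\le F(x)-F(y)-\langle\nabla F(y),x-y\rangle$. Let $\theta^*\in\Omega$ minimize $F$ over $\Omega$. Let $P$ be a probability measure and let $G(\theta,\xi)$ be stochastic gradients with $\mathbb E_{\xi\sim P}\,G(\theta,\xi)=\nabla F(\theta)$ and $\mathbb E_{\xi\sim P}\|G(\theta,\xi)-\nabla F(\theta)\|^2\le\sigma^2$ for all $\theta\in\Omega$. The procedure $\mathrm{condg}(w,u,\gamma,\eta)$ starts with $u_1=u$.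 For $t=1,2,\dots$ it takes any $v_t\in\Omega$ that attains $V(u_t)=\max_{x\in\Omega}\langle w+\frac1\gamma(u_t-u),u_t-x\rangle$; if $V(u_t)\le\eta$ it stops and returns $u_t$; otherwise it sets $u_{t+1}=(1-s_t)u_t+s_tv_t$ with $s_t=\min\Big\{1,\frac{\langle\frac1\gamma(u-u_t)-w,\;v_t-u_t\rangle}{\frac1\gamma\|v_t-u_t\|^2}\Big\}$. Let $N\ge1$ and $\theta_0^{ag}=\theta_0\in\Omega$. Stochastic NCGS runs, for $k=1,\dots,R$, $$\theta_k^{md}=(1-\alpha_k)\theta_{k-1}^{ag}+\alpha_k\theta_{k-1},\quad \bar G_k=\frac1{m_k}\sum_{i=1}^{m_k}G(\theta_k^{md},\xi_{k,i}),$$ $$\theta_k=\mathrm{condg}(\bar G_k,\theta_{k-1},\lambda_k,\eta_k),\quad \theta_k^{ag}=\mathrm{condg}(\bar G_k,\theta_k^{md},\beta_k,\chi_k),$$ where the samples $\xi_{k,i}$ are i.i.d. with law $P$, the choices of the points $v_t$ made in iteration $k$ do not depend on samples of later iterations, and the random index $R\in\{1,\dots,N\}$ is independent of the samples and of the choices of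 the $v_t$. Set $\alpha_k=\frac2{k+1}$, $\beta_k=\frac1{2L}$, $\lambda_k=\frac{k\beta_k}2$, $\eta_k=\chi_k=\frac1N$, $m_k=k$, and $\mathrm{Prob}\{R=k\}=\Gamma_k^{-1}/\sum_{j=1}^N\Gamma_j^{-1}$ with $\Gamma_k=\frac2{k(k+1)}$. Then $\|g(\theta_R^{md},\bar G_R,\beta_R)\|^2$ is integrable and $$\mathbb E\big[\|g(\theta_R^{md},\bar G_R,\beta_R)\|^2\big]\le192L\Big(\frac{4L\|\theta_0-\theta^*\|^2}{N^2(N+1)}+\frac lN\big(\|\theta^*\|^2+2M^2\big)+\frac1N+\frac{3\sigma^2}{2LN}\Big).$$ -/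

import Mathlib

open MeasureTheory ProbabilityTheory

namespace NCGS

noncomputable section

/-! Smoothness of the objective on the feasible set -/

/-- `F` is `L`-smooth on `Ω`: it is differentiable at the points of `Ω` and its gradient is
`L`-Lipschitz on `Ω`. -/
structure SmoothOn {E : Type*} [NormedAddCommGroup E] [InnerProductSpace ℝ E] [CompleteSpace E]
    (F : E → ℝ) (Ω : Set E) (L : ℝ) : Prop where
  differentiableAt : ∀ x ∈ Ω, DifferentiableAt ℝ F x
  lipschitz : ∀ x ∈ Ω, ∀ y ∈ Ω, ‖gradient F x - gradient F y‖ ≤ L * ‖x - y‖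

/-- `F` is `l`-lower smooth on `Ω`. -/
def LowerSmoothOn {E : Type*} [NormedAddCommGroup E] [InnerProductSpace ℝ E] [CompleteSpace E]
    (F : E → ℝ) (Ω : Set E) (l : ℝ) : Prop :=
  ∀ x ∈ Ω, ∀ y ∈ Ω, -(l / 2) * ‖x - y‖ ^ 2 ≤ F x - F y - inner ℝ (gradient F y) (x - y)

/-! The prox-mapping and the gradient mapping -/

/-- `z` minimizes `θ ↦ ⟨w, θ⟩ + ‖θ - x‖² / (2γ)` over `Ω`. -/
def IsProx {E : Type*} [NormedAddCommGroup E] [InnerProductSpace ℝ E]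
    (Ω : Set E) (x w : E) (γ : ℝ) (z : E) : Prop :=
  z ∈ Ω ∧ ∀ θ ∈ Ω,
    inner ℝ w z + 1 / (2 * γ) * ‖z - x‖ ^ 2 ≤ inner ℝ w θ + 1 / (2 * γ) * ‖θ - x‖ ^ 2

/-- The prox-mapping `ψ(x, w, γ)`. The minimizer exists and is unique whenever `γ > 0` and `Ω` is
nonempty, closed and convex in a Hilbert space; the value is `x` if there is no minimizer. -/
def psi {E : Type*} [NormedAddCommGroup E] [InnerProductSpace ℝ E]
    (Ω : Set E) (x w : E) (γ : ℝ) : E :=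
  open Classical in if h : ∃ z, IsProx Ω x w γ z then h.choose else x

/-- The gradient mapping `g(θ, w, γ) = (θ - ψ(θ, w, γ)) / γ`. -/
def gradMap {E : Type*} [NormedAddCommGroup E] [InnerProductSpace ℝ E]
    (Ω : Set E) (θ w : E) (γ : ℝ) : E :=
  (1 / γ) • (θ - psi Ω θ w γ)

/-! The procedure `condg(l, u, γ, η)`, driven by the sequence `v` of the answers of the linear
oracle. The counter `t` starts at `0`. -/

/-- The iterates `u_t` of `condg`. -/
def condgIter {E : Type*} [NormedAddCommGroup E] [InnerProductSpace ℝ E]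
    (l u : E) (γ : ℝ) (v : ℕ → E) : ℕ → E
  | 0 => u
  | t + 1 =>
    let y := condgIter l u γ v t
    let s : ℝ := min 1 (inner ℝ ((1 / γ) • (u - y) - l) (v t - y) / ((1 / γ) * ‖v t - y‖ ^ 2))
    (1 - s) • y + s • v t

/-- The gradient `l + (u_t - u) / γ` of the subproblem at `u_t`. -/
def condgGrad {E : Type*} [NormedAddCommGroup E] [InnerProductSpace ℝ E]
    (l u : E) (γ : ℝ) (v : ℕ → E) (t : ℕ) : E :=
  l + (1 / γ) • (condgIter l u γ v t - u)

/-- The value `⟨l + (u_t - u) / γ, u_t - v_t⟩`; it is the maximum `V(u_t)` as soon as `v_t` is an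
optimal answer of the linear oracle. -/
def condgGap {E : Type*} [NormedAddCommGroup E] [InnerProductSpace ℝ E]
    (l u : E) (γ : ℝ) (v : ℕ → E) (t : ℕ) : ℝ :=
  inner ℝ (condgGrad l u γ v t) (condgIter l u γ v t - v t)

/-- The output of `condg`: the first `u_t` with `V(u_t) ≤ η`. -/
def condg {E : Type*} [NormedAddCommGroup E] [InnerProductSpace ℝ E]
    (l u : E) (γ η : ℝ) (v : ℕ → E) : E :=
  condgIter l u γ v (sInf {t : ℕ | condgGap l u γ v t ≤ η})

/-- As long as the procedure has not terminated, `v_t` is an optimal solution of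
`max_{x ∈ Ω} ⟨l + (u_t - u) / γ, u_t - x⟩` (any optimal solution is allowed). -/
def IsOracleAnswers {E : Type*} [NormedAddCommGroup E] [InnerProductSpace ℝ E]
    (Ω : Set E) (l u : E) (γ η : ℝ) (v : ℕ → E) : Prop :=
  ∀ t : ℕ, (∀ r < t, η < condgGap l u γ v r) →
    v t ∈ Ω ∧ ∀ x ∈ Ω,
      inner ℝ (condgGrad l u γ v t) (condgIter l u γ v t - x) ≤ condgGap l u γ v t

/-! Stochastic non-convex conditional gradient sliding -/

/-- The parameters of the method: step sizes `α_k, β_k, λ_k`, tolerances `η_k, χ_k`, and sizes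
`m_k` of the mini-batches. -/
structure Params where
  α : ℕ → ℝ
  β : ℕ → ℝ
  lam : ℕ → ℝ
  η : ℕ → ℝ
  χ : ℕ → ℝ
  m : ℕ → ℕ

/-- `α_k = 2/(k+1)`, `β_k = 1/(2L)`, `λ_k = k β_k / 2`, `η_k = χ_k = 1/N`, `m_k = k`. -/
def stdParams (L : ℝ) (N : ℕ) : Params where
  α k := 2 / ((k : ℝ) + 1)
  β _ := 1 / (2 * L)
  lam k := (k : ℝ) * (1 / (2 * L)) / 2
  η _ := 1 / (N : ℝ)
  χ _ := 1 / (N : ℝ)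
  m k := k

/-- `Γ_k = 2/(k(k+1))`. -/
def Gam (k : ℕ) : ℝ := 2 / ((k : ℝ) * ((k : ℝ) + 1))

/-- The mini-batch average `(1/m) ∑_{i < m} G(x, s_i)`. -/
def batchGrad {E S : Type*} [NormedAddCommGroup E] [InnerProductSpace ℝ E]
    (G : E → S → E) (m : ℕ) (x : E) (s : ℕ → S) : E :=
  (1 / (m : ℝ)) • ∑ i ∈ Finset.range m, G x (s i)

/-- The middle point `(1 - α) θ^{ag} + α θ` formed from the pair `z = (θ, θ^{ag})`. -/
def midPoint {E : Type*} [NormedAddCommGroup E] [InnerProductSpace ℝ E]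
    (α : ℝ) (z : E × E) : E :=
  (1 - α) • z.2 + α • z.1

/-- The pair `(θ_k, θ_k^{ag})` of the method started at `θ₀`, where `s k i` is the `i`-th sample of
the `k`-th mini-batch, and where `a k` and `b k` are the answers of the linear oracle in the calls
of `condg` that compute `θ_k` and `θ_k^{ag}`. -/
def state {E S : Type*} [NormedAddCommGroup E] [InnerProductSpace ℝ E]
    (G : E → S → E) (π : Params) (θ₀ : E) (s : ℕ → ℕ → S) (a b : ℕ → ℕ → E) : ℕ → E × E
  | 0 => (θ₀, θ₀)
  | k + 1 =>
    let z := state G π θ₀ s a b k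
    let x := midPoint (π.α (k + 1)) z
    let w := batchGrad G (π.m (k + 1)) x (s (k + 1))
    (condg w z.1 (π.lam (k + 1)) (π.η (k + 1)) (a (k + 1)),
      condg w x (π.β (k + 1)) (π.χ (k + 1)) (b (k + 1)))

/-- The point `θ_k^{md}`, for `k ≥ 1`. -/
def md {E S : Type*} [NormedAddCommGroup E] [InnerProductSpace ℝ E]
    (G : E → S → E) (π : Params) (θ₀ : E) (s : ℕ → ℕ → S) (a b : ℕ → ℕ → E) (k : ℕ) : E :=
  midPoint (π.α k) (state G π θ₀ s a b (k - 1))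

/-- The averaged stochastic gradient `Ḡ_k`, for `k ≥ 1`. -/
def Gbar {E S : Type*} [NormedAddCommGroup E] [InnerProductSpace ℝ E]
    (G : E → S → E) (π : Params) (θ₀ : E) (s : ℕ → ℕ → S) (a b : ℕ → ℕ → E) (k : ℕ) : E :=
  batchGrad G (π.m k) (md G π θ₀ s a b k) (s k)

/-- In the iterations `1, …, N` every call of the linear oracle is answered correctly. -/
def IsRun {E S : Type*} [NormedAddCommGroup E] [InnerProductSpace ℝ E]
    (Ω : Set E) (G : E → S → E) (π : Params) (N : ℕ) (θ₀ : E) (s : ℕ → ℕ → S)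
    (a b : ℕ → ℕ → E) : Prop :=
  ∀ k ∈ Finset.Icc 1 N,
    IsOracleAnswers Ω (Gbar G π θ₀ s a b k) (state G π θ₀ s a b (k - 1)).1
      (π.lam k) (π.η k) (a k) ∧
    IsOracleAnswers Ω (Gbar G π θ₀ s a b k) (md G π θ₀ s a b k)
      (π.β k) (π.χ k) (b k)

/-! The probabilistic setting -/

/-- For `ξ ∼ P`, `G(θ, ξ)` is an unbiased estimator of `∇F(θ)` with variance at most `σ²`, for all
`θ` in `Ω`. -/
structure IsStochasticGradient {E S : Type*} [NormedAddCommGroup E] [InnerProductSpace ℝ E]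
    [CompleteSpace E] [MeasurableSpace E] [MeasurableSpace S]
    (P : Measure S) (F : E → ℝ) (Ω : Set E) (σ : ℝ) (G : E → S → E) : Prop where
  measurable : Measurable (Function.uncurry G)
  integrable : ∀ θ ∈ Ω, Integrable (G θ) P
  unbiased : ∀ θ ∈ Ω, ∫ s, G θ s ∂P = gradient F θ
  integrable_sq : ∀ θ ∈ Ω, Integrable (fun s => ‖G θ s - gradient F θ‖ ^ 2) P
  variance_le : ∀ θ ∈ Ω, ∫ s, ‖G θ s - gradient F θ‖ ^ 2 ∂P ≤ σ ^ 2

/-- The samples `ξ_{k,i}`, `1 ≤ k ≤ N`, `i < m_k`, are drawn independently from `P`: those of the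
`k`-th mini-batch are revealed at time `k`, have law `P`, are mutually independent, and are jointly
independent of everything that happened in the iterations before `k`. -/
structure IsSampling {W S : Type*} [mW : MeasurableSpace W] [mS : MeasurableSpace S]
    (μ : Measure W) (P : Measure S) (ℱ : Filtration ℕ mW) (m : ℕ → ℕ) (N : ℕ)
    (ξ : ℕ → ℕ → W → S) : Prop where
  adapted : ∀ k ∈ Finset.Icc 1 N, ∀ i < m k, Measurable[ℱ k] (ξ k i)
  law : ∀ k ∈ Finset.Icc 1 N, ∀ i < m k, μ.map (ξ k i) = P
  indep_batch : ∀ k ∈ Finset.Icc 1 N, iIndepFun (fun i : Fin (m k) => ξ k i) μ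
  indep_past : ∀ k ∈ Finset.Icc 1 N,
    Indep (MeasurableSpace.comap (fun ω (i : Fin (m k)) => ξ k i ω) inferInstance) (ℱ (k - 1)) μ

/-- `R` is drawn independently of the whole run, with `Prob(R = k)` proportional to `1/Γ_k` on
`{1, …, N}`. -/
structure IsStoppingIndex {W : Type*} [mW : MeasurableSpace W]
    (μ : Measure W) (ℱ : Filtration ℕ mW) (N : ℕ) (R : W → ℕ) : Prop where
  measurable : Measurable R
  prob : ∀ k ∈ Finset.Icc 1 N,
    μ.real {ω | R ω = k} = (Gam k)⁻¹ / ∑ j ∈ Finset.Icc 1 N, (Gam j)⁻¹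
  indep : Indep (MeasurableSpace.comap R inferInstance) (ℱ N) μ

end

end NCGS

/-! The bound is a potential argument for an accelerated scheme, carried out along each run and
averaged only at the end. Write x, θ, y for θ_k^md, θ_k, θ_k^ag, and δ for the error of Ḡ_k at x.

On Ω one has ψ(x, 0, 1) = x, so the bound on the prox-mapping bounds Ω itself. Hence `condg`
terminates, and each call returns a feasible point whose variational inequality holds up to 1/N
(`condg_spec`). Combined with the descent lemma and lower smoothness, these inequalities give
`one_step`: the optimality gap of y is at most (1 - α) times the previous one plus errors, and L/4
‖y - x‖² is gained. The errors are the tolerances, ‖δ‖²/L, a term linear in δ, and a term in l for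
the missing convexity. Since y is an approximate prox point, ‖y - x‖ controls the gradient mapping
(`norm_gradMap_sq_le`).

With weights 1/Γ_k one has (1 - α_k)/Γ_k = 1/Γ_{k-1}, while α_k/(λ_k Γ_k) does not depend on k, so
the sum telescopes (`potential_succ_le`, `sum_norm_gradMap_sq_le`).

In expectation the term linear in δ vanishes, because it pairs δ with θ_{k-1} - θ*, which is
determined before the batch is drawn; ‖δ‖² costs at most σ²/k (`gradient_error_moments`). As R is
independent of the run, the expectation at R is the average with the same weights 1/Γ_k
(`integral_stoppingIndex`). Their sum is of order N³, which gives the rates (`weighted_bound_le`).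
-/

namespace NCGS

/-! ### The prox-mapping: existence, continuity, stability under inexact solution. -/

section Prox

variable {E : Type*} [NormedAddCommGroup E] [InnerProductSpace ℝ E]

/-- The objective of the prox-mapping expanded around `z`. -/
lemma prox_objective_expand (x w z θ : E) {γ : ℝ} (hγ : 0 < γ) :
    inner ℝ w θ + 1 / (2 * γ) * ‖θ - x‖ ^ 2 =
      inner ℝ w z + 1 / (2 * γ) * ‖z - x‖ ^ 2 + inner ℝ (w + (1 / γ) • (z - x)) (θ - z)
        + 1 / (2 * γ) * ‖θ - z‖ ^ 2 := by
  have h : θ - x = (z - x) + (θ - z) := by abel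
  have hw : inner ℝ w θ = inner ℝ w z + inner ℝ w (θ - z) := by
    rw [inner_sub_right]; ring
  rw [h, norm_add_sq_real, hw, inner_add_left, real_inner_smul_left]
  field_simp
  ring

/-- The variational inequality characterizing the prox-mapping. -/
lemma isProx_iff {Ω : Set E} (hΩ : Convex ℝ Ω) {x w z : E} {γ : ℝ} (hγ : 0 < γ) :
    IsProx Ω x w γ z ↔
      z ∈ Ω ∧ ∀ θ ∈ Ω, 0 ≤ inner ℝ (w + (1 / γ) • (z - x)) (θ - z) := by
  constructor
  · rintro ⟨hz, h⟩
    refine ⟨hz, fun θ hθ => ?_⟩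
    by_contra! hneg
    set c : ℝ := inner ℝ (w + (1 / γ) • (z - x)) (θ - z) with hc
    set q : ℝ := 1 / (2 * γ) * ‖θ - z‖ ^ 2 with hq
    have hq0 : 0 ≤ q := by positivity
    have key : ∀ t : ℝ, 0 ≤ t → t ≤ 1 → 0 ≤ t * c + t ^ 2 * q := by
      intro t ht0 ht1
      have hmem : (1 - t) • z + t • θ ∈ Ω := hΩ hz hθ (by linarith) ht0 (by ring)
      have h1 := h _ hmem
      rw [prox_objective_expand x w z ((1 - t) • z + t • θ) hγ] at h1
      have h2 : (1 - t) • z + t • θ - z = t • (θ - z) := by module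
      rw [h2, real_inner_smul_right, norm_smul, mul_pow, Real.norm_eq_abs, sq_abs] at h1
      rw [hc, hq]
      linarith
    have hq1 : 0 < 2 * (q + -c) := by linarith
    -- The minimizer of t c + t² q is -c/(2q), but q may vanish; adding -c > 0 to q keeps t in [0,
    -- 1/2] and the value still negative.
    have h1 := key (-c / (2 * (q + -c))) (by apply div_nonneg <;> linarith)
      (by rw [div_le_one hq1]; linarith)
    have h2 : -c / (2 * (q + -c)) * c + (-c / (2 * (q + -c))) ^ 2 * q =
        (-c) ^ 2 / (4 * (q + -c) ^ 2) * (q - 2 * (q + -c)) := by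
      have : q + -c ≠ 0 := by linarith
      field_simp
      ring
    rw [h2] at h1
    have h3 : 0 < (-c) ^ 2 / (4 * (q + -c) ^ 2) := by
      have : 0 < -c := by linarith
      have : 0 < q + -c := by linarith
      positivity
    nlinarith
  · rintro ⟨hz, h⟩
    refine ⟨hz, fun θ hθ => ?_⟩
    rw [prox_objective_expand x w z θ hγ]
    have h1 := h θ hθ
    have : 0 ≤ 1 / (2 * γ) * ‖θ - z‖ ^ 2 := by positivity
    linarith

/-- After completing the square, the objective is an affine function of ‖θ - (x - γ w)‖² with
positive slope, so the minimizer is the projection of x - γ w. -/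
lemma exists_isProx [CompleteSpace E] {Ω : Set E} (hΩc : IsClosed Ω) (hΩ : Convex ℝ Ω)
    (hne : Ω.Nonempty) (x w : E) {γ : ℝ} (hγ : 0 < γ) : ∃ z, IsProx Ω x w γ z := by
  obtain ⟨z, hz, hmin⟩ := exists_norm_eq_iInf_of_complete_convex hne hΩc.isComplete hΩ (x - γ • w)
  have h := (norm_eq_iInf_iff_real_inner_le_zero hΩ hz).1 hmin
  refine ⟨z, (isProx_iff hΩ hγ).2 ⟨hz, fun θ hθ => ?_⟩⟩
  have h1 := h θ hθ
  have h2 : w + (1 / γ) • (z - x) = -((1 / γ) • (x - γ • w - z)) := by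
    have : (1 / γ) • (γ • w) = w := by rw [smul_smul, one_div_mul_cancel hγ.ne', one_smul]
    rw [smul_sub, smul_sub, smul_sub, this]; abel
  rw [h2, inner_neg_left, real_inner_smul_left]
  have : 0 < 1 / γ := by positivity
  nlinarith

lemma psi_isProx [CompleteSpace E] {Ω : Set E} (hΩc : IsClosed Ω) (hΩ : Convex ℝ Ω)
    (hne : Ω.Nonempty) (x w : E) {γ : ℝ} (hγ : 0 < γ) : IsProx Ω x w γ (psi Ω x w γ) := by
  have h := exists_isProx hΩc hΩ hne x w hγ
  rw [psi, dif_pos h]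
  exact h.choose_spec

/-- The prox-mapping is nonexpansive as a function of `x - γ w`. -/
lemma norm_psi_sub_psi_le [CompleteSpace E] {Ω : Set E} (hΩc : IsClosed Ω) (hΩ : Convex ℝ Ω)
    (hne : Ω.Nonempty) (x w x' w' : E) {γ : ℝ} (hγ : 0 < γ) :
    ‖psi Ω x w γ - psi Ω x' w' γ‖ ≤ ‖(x - γ • w) - (x' - γ • w')‖ := by
  obtain ⟨hz, h⟩ := (isProx_iff hΩ hγ).1 (psi_isProx hΩc hΩ hne x w hγ)
  obtain ⟨hz', h'⟩ := (isProx_iff hΩ hγ).1 (psi_isProx hΩc hΩ hne x' w' hγ)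
  set z := psi Ω x w γ
  set z' := psi Ω x' w' γ
  have h1 := h z' hz'
  have h2 := h' z hz
  have e : (x - γ • w) - (x' - γ • w') =
      (z - z') + γ • (w' + (1 / γ) • (z' - x')) - γ • (w + (1 / γ) • (z - x)) := by
    simp only [smul_add, smul_smul, mul_one_div_cancel hγ.ne', one_smul]
    abel
  -- The two variational inequalities, each tested at the other solution, add up to firm
  -- nonexpansiveness; Cauchy–Schwarz then finishes.
  have h3 : ‖z - z'‖ ^ 2 ≤ inner ℝ ((x - γ • w) - (x' - γ • w')) (z - z') := by
    rw [e, inner_sub_left, inner_add_left, real_inner_smul_left, real_inner_smul_left,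
      real_inner_self_eq_norm_sq]
    rw [← neg_sub z z', inner_neg_right] at h1
    nlinarith [mul_nonneg hγ.le h2, mul_nonneg hγ.le h1]
  have h4 := real_inner_le_norm ((x - γ • w) - (x' - γ • w')) (z - z')
  by_contra! hlt
  nlinarith [norm_nonneg ((x - γ • w) - (x' - γ • w'))]

/-- Used to show that the gradient mapping along the method is measurable. -/
lemma continuous_psi [CompleteSpace E] {Ω : Set E} (hΩc : IsClosed Ω) (hΩ : Convex ℝ Ω)
    (hne : Ω.Nonempty) {γ : ℝ} (hγ : 0 < γ) :
    Continuous fun q : E × E => psi Ω q.1 q.2 γ := by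
  rw [continuous_iff_continuousAt]
  intro q
  rw [ContinuousAt, tendsto_iff_norm_sub_tendsto_zero]
  have hc : Continuous fun q' : E × E => ‖(q'.1 - γ • q'.2) - (q.1 - γ • q.2)‖ := by fun_prop
  have h0 : Filter.Tendsto (fun q' : E × E => ‖(q'.1 - γ • q'.2) - (q.1 - γ • q.2)‖)
      (nhds q) (nhds 0) := by
    simpa using hc.tendsto q
  exact squeeze_zero (fun _ => norm_nonneg _)
    (fun q' => norm_psi_sub_psi_le hΩc hΩ hne q'.1 q'.2 q.1 q.2 hγ) h0

/-- With w = 0 the prox-mapping is the projection onto Ω. This is how a bound on `psi` becomes a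
bound on Ω. -/
lemma psi_zero [CompleteSpace E] {Ω : Set E} (hΩc : IsClosed Ω) (hΩ : Convex ℝ Ω)
    {x : E} (hx : x ∈ Ω) : psi Ω x 0 1 = x := by
  obtain ⟨-, h⟩ := (isProx_iff hΩ one_pos).1 (psi_isProx hΩc hΩ ⟨x, hx⟩ x 0 one_pos)
  have h1 := h x hx
  rw [zero_add, div_one, one_smul, ← neg_sub (psi Ω x 0 1) x, inner_neg_right,
    real_inner_self_eq_norm_sq] at h1
  have h2 : ‖psi Ω x 0 1 - x‖ = 0 := by
    have := norm_nonneg (psi Ω x 0 1 - x)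
    nlinarith
  exact sub_eq_zero.1 (norm_eq_zero.1 h2)

/-- An approximate solution of the subproblem is close to the prox-mapping. -/
lemma norm_sub_psi_sq_le [CompleteSpace E] {Ω : Set E} (hΩc : IsClosed Ω) (hΩ : Convex ℝ Ω)
    {x w y : E} {γ χ : ℝ} (hγ : 0 < γ) (hy : y ∈ Ω)
    (h : ∀ u ∈ Ω, inner ℝ (w + (1 / γ) • (y - x)) (y - u) ≤ χ) :
    ‖y - psi Ω x w γ‖ ^ 2 ≤ γ * χ := by
  obtain ⟨hz, hv⟩ := (isProx_iff hΩ hγ).1 (psi_isProx hΩc hΩ ⟨y, hy⟩ x w hγ)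
  set z := psi Ω x w γ
  -- The approximate condition is tested at the exact solution z, the exact one at y; their
  -- left-hand sides differ by ‖y - z‖²/γ.
  have h1 := h z hz
  have h2 := hv y hy
  have e : w + (1 / γ) • (y - x) = (w + (1 / γ) • (z - x)) + (1 / γ) • (y - z) := by module
  rw [e, inner_add_left, real_inner_smul_left, real_inner_self_eq_norm_sq] at h1
  have h3 : 1 / γ * ‖y - z‖ ^ 2 ≤ χ := by linarith
  rwa [one_div, inv_mul_le_iff₀ hγ] at h3

/-- The gradient mapping is controlled by the length of an inexact prox step. -/
lemma norm_gradMap_sq_le [CompleteSpace E] {Ω : Set E} (hΩc : IsClosed Ω) (hΩ : Convex ℝ Ω)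
    {x w y : E} {γ χ : ℝ} (hγ : 0 < γ) (hy : y ∈ Ω)
    (h : ∀ u ∈ Ω, inner ℝ (w + (1 / γ) • (y - x)) (y - u) ≤ χ) :
    ‖gradMap Ω x w γ‖ ^ 2 ≤ 2 / γ ^ 2 * ‖y - x‖ ^ 2 + 2 / γ * χ := by
  have h1 := norm_sub_psi_sq_le hΩc hΩ hγ hy h
  have h2 : ‖x - psi Ω x w γ‖ ^ 2 ≤ 2 * ‖y - x‖ ^ 2 + 2 * ‖y - psi Ω x w γ‖ ^ 2 := by
    have h3 : ‖x - psi Ω x w γ‖ ≤ ‖y - x‖ + ‖y - psi Ω x w γ‖ := by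
      rw [norm_sub_rev y x]
      exact norm_sub_le_norm_sub_add_norm_sub _ _ _
    nlinarith [sq_nonneg (‖y - x‖ - ‖y - psi Ω x w γ‖), norm_nonneg (x - psi Ω x w γ)]
  rw [gradMap, norm_smul, mul_pow, Real.norm_eq_abs, sq_abs]
  calc (1 / γ) ^ 2 * ‖x - psi Ω x w γ‖ ^ 2
      ≤ (1 / γ) ^ 2 * (2 * ‖y - x‖ ^ 2 + 2 * (γ * χ)) := by gcongr; linarith
    _ = 2 / γ ^ 2 * ‖y - x‖ ^ 2 + 2 / γ * χ := by field_simp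

end Prox

/-! ### Termination and output of `condg`, and the algebra of one iteration. -/

section Condg

variable {E : Type*} [NormedAddCommGroup E] [InnerProductSpace ℝ E]

/-- The exact line search of `condg` decreases the objective. -/
lemma condgIter_succ_objective_le {l u : E} {γ η Q : ℝ} {v : ℕ → E} {t : ℕ} (hγ : 0 < γ)
    (hη : 0 < η) (hQ : 0 < Q) (hgap : η < condgGap l u γ v t)
    (hvQ : 1 / γ * ‖v t - condgIter l u γ v t‖ ^ 2 ≤ Q) :
    inner ℝ l (condgIter l u γ v (t + 1))
        + 1 / (2 * γ) * ‖condgIter l u γ v (t + 1) - u‖ ^ 2 + η / 2 * min 1 (η / Q) ≤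
      inner ℝ l (condgIter l u γ v t) + 1 / (2 * γ) * ‖condgIter l u γ v t - u‖ ^ 2 := by
  set y := condgIter l u γ v t with hy
  set c := condgGap l u γ v t with hc
  set q := 1 / γ * ‖v t - y‖ ^ 2 with hq
  have hcq : inner ℝ ((1 / γ) • (u - y) - l) (v t - y) = c := by
    rw [hc, condgGap, condgGrad, ← hy, ← neg_sub (v t) y, inner_neg_right, ← inner_neg_left]
    congr 1
    module
  have hne : v t - y ≠ 0 := by
    intro h0
    rw [h0, inner_zero_right] at hcq
    linarith
  have hq0 : 0 < q := by
    have := norm_pos_iff.2 hne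
    positivity
  set s := min 1 (c / q) with hs
  have hstep : condgIter l u γ v (t + 1) = (1 - s) • y + s • v t := by
    rw [hs, ← hcq, hq]
    rfl
  have hsub : condgIter l u γ v (t + 1) - y = s • (v t - y) := by rw [hstep]; module
  have hsq : s * q ≤ c := by
    have : s ≤ c / q := min_le_right _ _
    rwa [le_div_iff₀ hq0] at this
  have hs_lower : min 1 (η / Q) ≤ s := by
    rw [hs]
    have : 0 ≤ c := by linarith
    gcongr
  have hs0 : 0 < s := lt_of_lt_of_le (lt_min one_pos (by positivity)) hs_lower
  rw [prox_objective_expand u l y _ hγ, hsub, real_inner_smul_right, norm_smul, mul_pow,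
    Real.norm_eq_abs, sq_abs]
  have e1 : inner ℝ (l + (1 / γ) • (y - u)) (v t - y) = -c := by
    rw [← hcq, ← inner_neg_left]
    congr 1
    module
  have e2 : 1 / (2 * γ) * (s ^ 2 * ‖v t - y‖ ^ 2) = s * (s * q) / 2 := by
    rw [hq]; field_simp
  rw [e1, e2]
  -- The objective drops by s c - s² q/2, which is at least s c/2 because s q ≤ c; the lower bounds
  -- on c and s do not depend on t.
  have h3 : s * (s * q) ≤ s * c := by gcongr
  have h4 : η / 2 * min 1 (η / Q) ≤ c / 2 * s := by gcongr; linarith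
  linarith

/-- Before termination the gap, which is the numerator of the step size, exceeds η > 0; so the step
lies in [0, 1] and the iterate is a convex combination. -/
lemma condgIter_mem {Ω : Set E} (hΩ : Convex ℝ Ω) {l u : E} {γ η : ℝ} {v : ℕ → E} (hγ : 0 < γ)
    (hη : 0 < η) (hu : u ∈ Ω) (h : IsOracleAnswers Ω l u γ η v) (t : ℕ)
    (ht : ∀ r < t, η < condgGap l u γ v r) : condgIter l u γ v t ∈ Ω := by
  induction t with
  | zero => exact hu
  | succ t ih =>
    have hmem := ih fun r hr => ht r (by omega)
    have hv := (h t fun r hr => ht r (by omega)).1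
    have hgap := ht t (by omega)
    have hcq : inner ℝ ((1 / γ) • (u - condgIter l u γ v t) - l) (v t - condgIter l u γ v t)
        = condgGap l u γ v t := by
      rw [condgGap, condgGrad, ← neg_sub (v t), inner_neg_right, ← inner_neg_left]
      congr 1
      module
    refine hΩ hmem hv ?_ ?_ (by ring)
    · exact sub_nonneg.2 (min_le_left _ _)
    · rw [hcq]
      refine le_min zero_le_one (div_nonneg (by linarith) (by positivity))

/-- On a bounded feasible set, `condg` terminates. -/
lemma exists_condgGap_le {Ω : Set E} (hΩ : Convex ℝ Ω) {M : ℝ} (hM : ∀ x ∈ Ω, ‖x‖ ≤ M)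
    {l u : E} {γ η : ℝ} {v : ℕ → E} (hγ : 0 < γ) (hη : 0 < η) (hu : u ∈ Ω)
    (h : IsOracleAnswers Ω l u γ η v) : ∃ t, condgGap l u γ v t ≤ η := by
  by_contra! hgap
  have hmem : ∀ t, condgIter l u γ v t ∈ Ω := fun t =>
    condgIter_mem hΩ hγ hη hu h t fun r _ => hgap r
  have hvmem : ∀ t, v t ∈ Ω := fun t => (h t fun r _ => hgap r).1
  have hM0 : 0 ≤ M := (norm_nonneg u).trans (hM u hu)
  -- A bound on ‖v_t - u_t‖²/γ uniform in t; the summand 1 keeps it positive when M = 0.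
  set Q : ℝ := 1 / γ * (M + M) ^ 2 + 1 with hQ
  have hQ0 : 0 < Q := by positivity
  have hvQ : ∀ t, 1 / γ * ‖v t - condgIter l u γ v t‖ ^ 2 ≤ Q := by
    intro t
    have h1 : ‖v t - condgIter l u γ v t‖ ≤ M + M :=
      (norm_sub_le _ _).trans (add_le_add (hM _ (hvmem t)) (hM _ (hmem t)))
    have : 1 / γ * ‖v t - condgIter l u γ v t‖ ^ 2 ≤ 1 / γ * (M + M) ^ 2 := by gcongr
    linarith
  set c : ℝ := η / 2 * min 1 (η / Q)
  have hc : 0 < c := mul_pos (by positivity) (lt_min one_pos (by positivity))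
  have hdec : ∀ t : ℕ, inner ℝ l (condgIter l u γ v t)
      + 1 / (2 * γ) * ‖condgIter l u γ v t - u‖ ^ 2 + t * c ≤ inner ℝ l u := by
    intro t
    induction t with
    | zero => simp [condgIter]
    | succ t ih =>
      have := condgIter_succ_objective_le hγ hη hQ0 (hgap t) (hvQ t)
      change _ + c ≤ _ at this
      push_cast
      linarith
  -- A decrease of at least c per step is impossible forever, since the objective is at least -‖l‖ M
  -- on Ω.
  obtain ⟨n, hn⟩ := exists_nat_gt ((inner ℝ l u + ‖l‖ * M) / c)
  rw [div_lt_iff₀ hc] at hn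
  have h1 := hdec n
  have h2 : -(‖l‖ * M) ≤ inner ℝ l (condgIter l u γ v n) := by
    have h3 := neg_le_of_abs_le (abs_real_inner_le_norm l (condgIter l u γ v n))
    have : ‖l‖ * ‖condgIter l u γ v n‖ ≤ ‖l‖ * M := by gcongr; exact hM _ (hmem n)
    linarith
  have h3 : 0 ≤ 1 / (2 * γ) * ‖condgIter l u γ v n - u‖ ^ 2 := by positivity
  linarith

/-- `condg` returns a feasible point that solves its subproblem up to `η`. -/
lemma condg_spec {Ω : Set E} (hΩ : Convex ℝ Ω) {M : ℝ} (hM : ∀ x ∈ Ω, ‖x‖ ≤ M)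
    {l u : E} {γ η : ℝ} {v : ℕ → E} (hγ : 0 < γ) (hη : 0 < η) (hu : u ∈ Ω)
    (h : IsOracleAnswers Ω l u γ η v) :
    condg l u γ η v ∈ Ω ∧ ∀ x ∈ Ω,
      inner ℝ (l + (1 / γ) • (condg l u γ η v - u)) (condg l u γ η v - x) ≤ η := by
  -- Termination rules out the default value `sInf ∅ = 0`, so the returned iterate really satisfies
  -- the stopping test.
  have hne : {t : ℕ | condgGap l u γ v t ≤ η}.Nonempty := exists_condgGap_le hΩ hM hγ hη hu h
  have hlt : ∀ r < sInf {t : ℕ | condgGap l u γ v t ≤ η}, η < condgGap l u γ v r := fun r hr =>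
    not_le.1 (Nat.notMem_of_lt_sInf hr)
  exact ⟨condgIter_mem hΩ hγ hη hu h _ hlt,
    fun x hx => ((h _ hlt).2 x hx).trans (Nat.sInf_mem hne)⟩

/-- An approximate stationarity condition rewritten with the three-point identity. -/
lemma inner_sub_le_of_approx {w y x u : E} {γ χ : ℝ}
    (h : inner ℝ (w + (1 / γ) • (y - x)) (y - u) ≤ χ) :
    inner ℝ w (y - u) ≤ χ + 1 / (2 * γ) * (‖x - u‖ ^ 2 - ‖y - u‖ ^ 2 - ‖y - x‖ ^ 2) := by
  rw [inner_add_left, real_inner_smul_left] at h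
  have e : x - u = (y - u) - (y - x) := by abel
  rw [e, norm_sub_sq_real, real_inner_comm (y - x)]
  have : 1 / (2 * γ) = 1 / γ / 2 := by ring
  rw [this]
  linarith

/-- The error caused by the lack of convexity in one iteration. -/
lemma lower_error_le {Ω : Set E} {l M α : ℝ} (hΩ : Convex ℝ Ω) (hM : ∀ x ∈ Ω, ‖x‖ ≤ M) (hl : 0 ≤ l)
    (hα0 : 0 ≤ α) (hα1 : α ≤ 1) {θs θ' y' : E} (hθ' : θ' ∈ Ω) (hy' : y' ∈ Ω) :
    l / 2 * (α * ‖θs - midPoint α (θ', y')‖ ^ 2 + (1 - α) * ‖y' - midPoint α (θ', y')‖ ^ 2) ≤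
      l * α * (‖θs‖ ^ 2 + 2 * M ^ 2) := by
  set x := midPoint α (θ', y') with hx
  have hx' : x = (1 - α) • y' + α • θ' := hx
  have hxΩ : x ∈ Ω := hx' ▸ hΩ hy' hθ' (by linarith) hα0 (by ring)
  have hbound : ∀ u ∈ Ω, ‖u‖ ^ 2 ≤ M ^ 2 := fun u hu =>
    pow_le_pow_left₀ (norm_nonneg u) (hM u hu) 2
  have hdist : ∀ u v : E, ‖u - v‖ ^ 2 ≤ 2 * ‖u‖ ^ 2 + 2 * ‖v‖ ^ 2 := fun u v => by
    have := parallelogram_law_with_norm ℝ u v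
    nlinarith [sq_nonneg ‖u + v‖]
  -- This makes the second error term carry a factor α too, so the whole error is proportional to α.
  have e3 : y' - x = α • (y' - θ') := by rw [hx']; module
  rw [e3, norm_smul, mul_pow, Real.norm_eq_abs, sq_abs]
  have h3 := hdist θs x
  have h4 := hdist y' θ'
  have h5 := hbound x hxΩ
  have h6 := hbound y' hy'
  have h7 := hbound θ' hθ'
  -- Here α(1 - α) ≤ 1/4 cancels the 4 of ‖y' - θ'‖² ≤ 4M².
  have h8 : α * (1 - α) * ‖y' - θ'‖ ^ 2 ≤ M ^ 2 := by
    have : α * (1 - α) ≤ 1 / 4 := by nlinarith [sq_nonneg (α - 1 / 2)]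
    have : α * (1 - α) * ‖y' - θ'‖ ^ 2 ≤ 1 / 4 * ‖y' - θ'‖ ^ 2 := by gcongr
    linarith
  have h9 : α * ‖θs - x‖ ^ 2 + (1 - α) * (α ^ 2 * ‖y' - θ'‖ ^ 2) ≤
      α * (2 * (‖θs‖ ^ 2 + 2 * M ^ 2)) := by
    have : α * ‖θs - x‖ ^ 2 + (1 - α) * (α ^ 2 * ‖y' - θ'‖ ^ 2) =
        α * (‖θs - x‖ ^ 2 + α * (1 - α) * ‖y' - θ'‖ ^ 2) := by ring
    rw [this]
    have := sq_nonneg M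
    gcongr
    linarith
  calc _ ≤ l / 2 * (α * (2 * (‖θs‖ ^ 2 + 2 * M ^ 2))) := by gcongr
    _ = _ := by ring

/-- The decomposition of the inner products that is behind `one_step`. -/
lemma inner_split (α : ℝ) (θ' y' θ y θs g w : E) :
    inner ℝ g (y - midPoint α (θ', y')) + α * inner ℝ g (midPoint α (θ', y') - θs)
        + (1 - α) * inner ℝ g (midPoint α (θ', y') - y') =
      inner ℝ w (y - ((1 - α) • y' + α • θ)) + α * inner ℝ w (θ - θs)
        - inner ℝ (w - g) (y - midPoint α (θ', y')) - α * inner ℝ (w - g) (θ' - θs) := by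
  simp only [midPoint, inner_sub_left, inner_sub_right, inner_add_right, real_inner_smul_right]
  ring

end Condg

/-! ### The descent lemma and the one-step inequality. -/

section Descent

variable {E : Type*} [NormedAddCommGroup E] [InnerProductSpace ℝ E] [CompleteSpace E]

/-- The descent lemma on a convex set. -/
lemma SmoothOn.le_quadratic {F : E → ℝ} {Ω : Set E} {L : ℝ} (hF : SmoothOn F Ω L)
    (hΩ : Convex ℝ Ω) {x y : E} (hx : x ∈ Ω) (hy : y ∈ Ω) :
    F y ≤ F x + inner ℝ (gradient F x) (y - x) + L / 2 * ‖y - x‖ ^ 2 := by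
  set d := y - x with hd
  have hmem : ∀ t ∈ Set.Icc (0 : ℝ) 1, x + t • d ∈ Ω := by
    intro t ht
    have : x + t • d = (1 - t) • x + t • y := by rw [hd]; module
    rw [this]
    exact hΩ hx hy (by linarith [ht.2]) ht.1 (by ring)
  have hderiv : ∀ t ∈ Set.Icc (0 : ℝ) 1,
      HasDerivAt (fun t : ℝ => F (x + t • d) - t * inner ℝ (gradient F x) d
        - L / 2 * t ^ 2 * ‖d‖ ^ 2)
        (inner ℝ (gradient F (x + t • d)) d - inner ℝ (gradient F x) d - L * t * ‖d‖ ^ 2) t := by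
    intro t ht
    have h1 : HasDerivAt (fun t : ℝ => x + t • d) d t := by
      simpa using ((hasDerivAt_id t).smul_const d).const_add x
    have h2 := (hF.differentiableAt _ (hmem t ht)).hasGradientAt.hasFDerivAt.comp_hasDerivAt t h1
    have h3 : HasDerivAt (fun t : ℝ => t * inner ℝ (gradient F x) d)
        (inner ℝ (gradient F x) d) t := by
      simpa using (hasDerivAt_id t).mul_const (inner ℝ (gradient F x) d)
    have h4 : HasDerivAt (fun t : ℝ => L / 2 * t ^ 2 * ‖d‖ ^ 2) (L * t * ‖d‖ ^ 2) t := by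
      have := ((hasDerivAt_pow 2 t).const_mul (L / 2)).mul_const (‖d‖ ^ 2)
      exact this.congr_deriv (by push_cast; ring)
    exact (h2.sub h3).sub h4
  -- Along the segment, F minus its quadratic upper model has nonpositive derivative by the
  -- Lipschitz bound; the endpoints are then compared.
  have hanti := antitoneOn_of_deriv_nonpos (convex_Icc (0 : ℝ) 1)
    (fun t ht => (hderiv t ht).continuousAt.continuousWithinAt)
    (fun t ht => (hderiv t (interior_subset ht)).differentiableAt.differentiableWithinAt)
    (fun t ht => by
      have ht' := interior_subset ht
      rw [(hderiv t ht').deriv, ← inner_sub_left]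
      have h1 := real_inner_le_norm (gradient F (x + t • d) - gradient F x) d
      have h2 := hF.lipschitz _ (hmem t ht') _ hx
      rw [add_sub_cancel_left, norm_smul, Real.norm_eq_abs, abs_of_nonneg ht'.1] at h2
      have h3 := mul_le_mul_of_nonneg_right h2 (norm_nonneg d)
      nlinarith)
  have h := hanti (Set.left_mem_Icc.2 zero_le_one) (Set.right_mem_Icc.2 zero_le_one) zero_le_one
  have e : x + d = y := by rw [hd]; abel
  simp only [one_smul, e, zero_smul, add_zero] at h
  linarith

/-- One iteration of the accelerated scheme. -/
lemma one_step {F : E → ℝ} {Ω : Set E} {L l M α lam η χ : ℝ} (hL : 0 < L) (hl : 0 ≤ l)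
    (hΩ : Convex ℝ Ω) (hM : ∀ x ∈ Ω, ‖x‖ ≤ M)
    (hF : SmoothOn F Ω L) (hFl : LowerSmoothOn F Ω l)
    (hα0 : 0 ≤ α) (hα1 : α ≤ 1) (hlam : 0 < lam) (hαlam : α * lam ≤ 1 / (2 * L))
    {θs θ' y' x θ y w : E} (hθs : θs ∈ Ω) (hθ' : θ' ∈ Ω) (hy' : y' ∈ Ω)
    (hx : x = midPoint α (θ', y')) (hθ : θ ∈ Ω) (hy : y ∈ Ω)
    (h1 : ∀ u ∈ Ω, inner ℝ (w + (1 / lam) • (θ - θ')) (θ - u) ≤ η)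
    (h2 : ∀ u ∈ Ω, inner ℝ (w + (1 / (1 / (2 * L))) • (y - x)) (y - u) ≤ χ) :
    L / 4 * ‖y - x‖ ^ 2 + (F y - F θs) ≤ (1 - α) * (F y' - F θs) + χ + α * η
      + α / (2 * lam) * (‖θ' - θs‖ ^ 2 - ‖θ - θs‖ ^ 2) + ‖w - gradient F x‖ ^ 2 / L
      - α * inner ℝ (w - gradient F x) (θ' - θs) + l * α * (‖θs‖ ^ 2 + 2 * M ^ 2) := by
  have hx' : x = (1 - α) • y' + α • θ' := hx
  have hxΩ : x ∈ Ω := hx' ▸ hΩ hy' hθ' (by linarith) hα0 (by ring)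
  have hdesc := hF.le_quadratic hΩ hxΩ hy
  have hlow1 := hFl θs hθs x hxΩ
  have hlow2 := hFl y' hy' x hxΩ
  -- The test point of the second subproblem is x with θ' replaced by the new θ, so it is at
  -- distance only α ‖θ' - θ‖ from x.
  have hu : (1 - α) • y' + α • θ ∈ Ω := hΩ hy' hθ (by linarith) hα0 (by ring)
  have k1 := inner_sub_le_of_approx (h1 θs hθs)
  have k2 := inner_sub_le_of_approx (h2 _ hu)
  have e1 : x - ((1 - α) • y' + α • θ) = α • (θ' - θ) := by rw [hx']; module
  have e2 : 1 / (2 * (1 / (2 * L))) = L := by field_simp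
  rw [e1, e2, norm_smul, mul_pow, Real.norm_eq_abs, sq_abs, norm_sub_rev θ' θ] at k2
  set g := gradient F x
  set δ := w - g with hδ
  -- The budget for ‖y - x‖²: the second subproblem supplies L, the descent lemma spends L/2 and
  -- Young's inequality L/4, leaving L/4.
  have hyoung : -inner ℝ δ (y - x) ≤ ‖δ‖ ^ 2 / L + L / 4 * ‖y - x‖ ^ 2 := by
    have := neg_le_of_abs_le (abs_real_inner_le_norm δ (y - x))
    have h3 : ‖δ‖ * ‖y - x‖ ≤ ‖δ‖ ^ 2 / L + L / 4 * ‖y - x‖ ^ 2 := by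
      have h4 : 0 ≤ (‖δ‖ - L / 2 * ‖y - x‖) ^ 2 / L := by positivity
      have h5 : (‖δ‖ - L / 2 * ‖y - x‖) ^ 2 / L =
          ‖δ‖ ^ 2 / L + L / 4 * ‖y - x‖ ^ 2 - ‖δ‖ * ‖y - x‖ := by
        field_simp; ring
      linarith
    linarith
  -- The condition on α λ lets the negative term of the first subproblem absorb the cost of the
  -- chosen test point.
  have hcoef : α ^ 2 * L * ‖θ - θ'‖ ^ 2 ≤ α / (2 * lam) * ‖θ - θ'‖ ^ 2 := by
    have h3 : α ^ 2 * L ≤ α / (2 * lam) := by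
      rw [le_div_iff₀ (by positivity)]
      rw [le_div_iff₀ (by positivity)] at hαlam
      nlinarith
    gcongr
  have hlower : l / 2 * (α * ‖θs - x‖ ^ 2 + (1 - α) * ‖y' - x‖ ^ 2) ≤
      l * α * (‖θs‖ ^ 2 + 2 * M ^ 2) := by
    rw [hx]
    exact lower_error_le hΩ hM hl hα0 hα1 hθ' hy'
  have i1 := inner_split α θ' y' θ y θs g w
  rw [← hx, ← hδ] at i1
  have i2 : inner ℝ g (θs - x) = -inner ℝ g (x - θs) := by rw [← inner_neg_right, neg_sub]
  have i3 : inner ℝ g (y' - x) = -inner ℝ g (x - y') := by rw [← inner_neg_right, neg_sub]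
  rw [i2] at hlow1
  rw [i3] at hlow2
  have m1 := mul_le_mul_of_nonneg_left hlow1 hα0
  have m2 := mul_le_mul_of_nonneg_left hlow2 (sub_nonneg.2 hα1)
  have m3 := mul_le_mul_of_nonneg_left k1 hα0
  have e4 : α / (2 * lam) = α * (1 / (2 * lam)) := by ring
  rw [e4] at hcoef ⊢
  generalize 1 / (2 * lam) = c at *
  have hdrop : 0 ≤ L * ‖y - ((1 - α) • y' + α • θ)‖ ^ 2 := by positivity
  linarith

end Descent

lemma inv_Gam (k : ℕ) : (Gam k)⁻¹ = (k : ℝ) * ((k : ℝ) + 1) / 2 := by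
  rw [Gam, inv_div]

lemma inv_Gam_nonneg (k : ℕ) : 0 ≤ (Gam k)⁻¹ := by
  rw [inv_Gam]; positivity

/-! ### Feasibility and the telescoping potential along one run. -/

section Run

variable {E S : Type*} [NormedAddCommGroup E] [InnerProductSpace ℝ E] {Ω : Set E} {M L : ℝ}
  {G : E → S → E} {N : ℕ} {θ₀ : E} {s : ℕ → ℕ → S} {a b : ℕ → ℕ → E}

lemma stdParams_α_mem (L : ℝ) (N n : ℕ) :
    0 ≤ (stdParams L N).α (n + 1) ∧ (stdParams L N).α (n + 1) ≤ 1 := by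
  have hn : (0 : ℝ) ≤ n := n.cast_nonneg
  simp only [stdParams, Nat.cast_add, Nat.cast_one]
  refine ⟨by positivity, ?_⟩
  rw [div_le_one (by linarith)]
  linarith

lemma midPoint_mem (hΩ : Convex ℝ Ω) (n : ℕ) {z : E × E} (h1 : z.1 ∈ Ω) (h2 : z.2 ∈ Ω) :
    midPoint ((stdParams L N).α (n + 1)) z ∈ Ω :=
  hΩ h2 h1 (by linarith [(stdParams_α_mem L N n).2]) (stdParams_α_mem L N n).1 (by ring)

/-- The two calls of `condg` in one iteration are successful. -/
lemma state_succ_spec (hΩ : Convex ℝ Ω) (hM : ∀ x ∈ Ω, ‖x‖ ≤ M) (hL : 0 < L)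
    (hrun : IsRun Ω G (stdParams L N) N θ₀ s a b) {n : ℕ} (hn : n < N)
    (h1 : (state G (stdParams L N) θ₀ s a b n).1 ∈ Ω)
    (h2 : (state G (stdParams L N) θ₀ s a b n).2 ∈ Ω) :
    ((state G (stdParams L N) θ₀ s a b (n + 1)).1 ∈ Ω ∧ ∀ u ∈ Ω,
      inner ℝ (Gbar G (stdParams L N) θ₀ s a b (n + 1) + (1 / (stdParams L N).lam (n + 1)) •
        ((state G (stdParams L N) θ₀ s a b (n + 1)).1 - (state G (stdParams L N) θ₀ s a b n).1))
        ((state G (stdParams L N) θ₀ s a b (n + 1)).1 - u) ≤ 1 / (N : ℝ)) ∧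
    ((state G (stdParams L N) θ₀ s a b (n + 1)).2 ∈ Ω ∧ ∀ u ∈ Ω,
      inner ℝ (Gbar G (stdParams L N) θ₀ s a b (n + 1) + (1 / (1 / (2 * L))) •
        ((state G (stdParams L N) θ₀ s a b (n + 1)).2 - md G (stdParams L N) θ₀ s a b (n + 1)))
        ((state G (stdParams L N) θ₀ s a b (n + 1)).2 - u) ≤ 1 / (N : ℝ)) := by
  have hN : (0 : ℝ) < N := by exact_mod_cast (by omega : 0 < N)
  have hlam : 0 < (stdParams L N).lam (n + 1) := by
    simp only [stdParams]; push_cast; positivity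
  obtain ⟨ha, hb⟩ := hrun (n + 1) (Finset.mem_Icc.2 ⟨by omega, by omega⟩)
  exact ⟨condg_spec hΩ hM hlam (η := 1 / (N : ℝ)) (by positivity) h1 ha,
    condg_spec hΩ hM (γ := 1 / (2 * L)) (by positivity) (η := 1 / (N : ℝ)) (by positivity)
      (midPoint_mem hΩ n h1 h2) hb⟩

lemma state_mem (hΩ : Convex ℝ Ω) (hM : ∀ x ∈ Ω, ‖x‖ ≤ M) (hL : 0 < L) (hθ₀ : θ₀ ∈ Ω)
    (hrun : IsRun Ω G (stdParams L N) N θ₀ s a b) {n : ℕ} (hn : n ≤ N) :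
    (state G (stdParams L N) θ₀ s a b n).1 ∈ Ω ∧
      (state G (stdParams L N) θ₀ s a b n).2 ∈ Ω := by
  induction n with
  | zero => exact ⟨hθ₀, hθ₀⟩
  | succ n ih =>
    obtain ⟨h1, h2⟩ := ih (by omega)
    obtain ⟨h3, h4⟩ := state_succ_spec hΩ hM hL hrun (by omega : n < N) h1 h2
    exact ⟨h3.1, h4.1⟩

lemma md_succ_mem (hΩ : Convex ℝ Ω) (hM : ∀ x ∈ Ω, ‖x‖ ≤ M) (hL : 0 < L) (hθ₀ : θ₀ ∈ Ω)
    (hrun : IsRun Ω G (stdParams L N) N θ₀ s a b) {n : ℕ} (hn : n ≤ N) :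
    md G (stdParams L N) θ₀ s a b (n + 1) ∈ Ω := by
  obtain ⟨h1, h2⟩ := state_mem hΩ hM hL hθ₀ hrun hn
  exact midPoint_mem hΩ n h1 h2

variable [CompleteSpace E]

/-- One iteration of the method, as a decrease of the weighted potential. -/
lemma potential_succ_le {F : E → ℝ} {l : ℝ} {θs : E} (hΩc : IsClosed Ω) (hΩ : Convex ℝ Ω)
    (hM : ∀ x ∈ Ω, ‖x‖ ≤ M) (hL : 0 < L) (hl : 0 ≤ l) (hF : SmoothOn F Ω L)
    (hFl : LowerSmoothOn F Ω l) (hθs : θs ∈ Ω) (hθ₀ : θ₀ ∈ Ω)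
    (hrun : IsRun Ω G (stdParams L N) N θ₀ s a b) {n : ℕ} (hn : n < N) :
    32 * L * (Gam (n + 1))⁻¹ * (F (state G (stdParams L N) θ₀ s a b (n + 1)).2 - F θs)
      + 64 * L ^ 2 * ‖(state G (stdParams L N) θ₀ s a b (n + 1)).1 - θs‖ ^ 2
      + (Gam (n + 1))⁻¹ * ‖gradMap Ω (md G (stdParams L N) θ₀ s a b (n + 1))
          (Gbar G (stdParams L N) θ₀ s a b (n + 1)) (1 / (2 * L))‖ ^ 2 ≤
    32 * L * (Gam n)⁻¹ * (F (state G (stdParams L N) θ₀ s a b n).2 - F θs)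
      + 64 * L ^ 2 * ‖(state G (stdParams L N) θ₀ s a b n).1 - θs‖ ^ 2
      + ((Gam (n + 1))⁻¹ * (68 * L / N)
        + 32 * L * l * ((n + 1 : ℕ) : ℝ) * (‖θs‖ ^ 2 + 2 * M ^ 2)
        + 32 * (Gam (n + 1))⁻¹ * ‖Gbar G (stdParams L N) θ₀ s a b (n + 1)
            - gradient F (md G (stdParams L N) θ₀ s a b (n + 1))‖ ^ 2
        - 32 * L * ((n + 1 : ℕ) : ℝ) * inner ℝ (Gbar G (stdParams L N) θ₀ s a b (n + 1)
            - gradient F (md G (stdParams L N) θ₀ s a b (n + 1)))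
            ((state G (stdParams L N) θ₀ s a b n).1 - θs)) := by
  obtain ⟨h1, h2⟩ := state_mem hΩ hM hL hθ₀ hrun hn.le
  obtain ⟨⟨h3, hv3⟩, ⟨h4, hv4⟩⟩ := state_succ_spec hΩ hM hL hrun hn h1 h2
  have hn0 : (0 : ℝ) ≤ n := n.cast_nonneg
  have hN : (0 : ℝ) < N := by exact_mod_cast (by omega : 0 < N)
  have hα : (stdParams L N).α (n + 1) = 2 / ((n : ℝ) + 2) := by
    simp only [stdParams]; push_cast; ring
  have hlam' : (stdParams L N).lam (n + 1) = ((n : ℝ) + 1) / (4 * L) := by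
    simp only [stdParams]; push_cast; field_simp; ring
  have hαlam : (stdParams L N).α (n + 1) * (stdParams L N).lam (n + 1) ≤ 1 / (2 * L) := by
    rw [hα, hlam', div_mul_div_comm, div_le_div_iff₀ (by positivity) (by positivity)]
    nlinarith
  have hstep := one_step (η := 1 / (N : ℝ)) (χ := 1 / (N : ℝ)) hL hl hΩ hM hF hFl
    (stdParams_α_mem L N n).1 (stdParams_α_mem L N n).2 (by rw [hlam']; positivity) hαlam hθs h1 h2
    (x := md G (stdParams L N) θ₀ s a b (n + 1)) rfl h3 h4 hv3 hv4
  have hg := norm_gradMap_sq_le hΩc hΩ (by positivity : 0 < 1 / (2 * L)) h4 hv4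
  set g := ‖gradMap Ω (md G (stdParams L N) θ₀ s a b (n + 1))
          (Gbar G (stdParams L N) θ₀ s a b (n + 1)) (1 / (2 * L))‖ ^ 2
  set d := ‖(state G (stdParams L N) θ₀ s a b (n + 1)).2
    - md G (stdParams L N) θ₀ s a b (n + 1)‖ ^ 2
  rw [hα, hlam'] at hstep
  simp only [inv_Gam]
  push_cast
  set i := inner ℝ (Gbar G (stdParams L N) θ₀ s a b (n + 1)
    - gradient F (md G (stdParams L N) θ₀ s a b (n + 1)))
    ((state G (stdParams L N) θ₀ s a b n).1 - θs)
  set δ := ‖Gbar G (stdParams L N) θ₀ s a b (n + 1)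
    - gradient F (md G (stdParams L N) θ₀ s a b (n + 1))‖ ^ 2
  set f := F (state G (stdParams L N) θ₀ s a b (n + 1)).2 - F θs
  set f' := F (state G (stdParams L N) θ₀ s a b n).2 - F θs
  set D := ‖(state G (stdParams L N) θ₀ s a b (n + 1)).1 - θs‖ ^ 2
  set D' := ‖(state G (stdParams L N) θ₀ s a b n).1 - θs‖ ^ 2
  set C := ‖θs‖ ^ 2 + 2 * M ^ 2
  generalize (n : ℝ) = x at *
  have e1 : 2 / (1 / (2 * L)) ^ 2 * d + 2 / (1 / (2 * L)) * (1 / (N : ℝ)) =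
      8 * L ^ 2 * d + 4 * L / N := by field_simp; ring
  rw [e1] at hg
  have hw : (0 : ℝ) ≤ (x + 1) * (x + 2) / 2 := by positivity
  -- Here k = x + 1 and the weight is 32 L/Γ_k: it turns L/4 ‖y - x‖² into 8 L² ‖y - x‖²/Γ_k, which
  -- is what the bound on the gradient mapping needs. The coefficient of the distances becomes 64 L²
  -- for every k.
  have m1 := mul_le_mul_of_nonneg_left hstep (mul_nonneg (by positivity : 0 ≤ 32 * L) hw)
  have m2 := mul_le_mul_of_nonneg_left hg hw
  have e2 : 32 * L * ((x + 1) * (x + 2) / 2) * ((1 - 2 / (x + 2)) * f' + 1 / (N : ℝ)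
      + 2 / (x + 2) * (1 / (N : ℝ)) + 2 / (x + 2) / (2 * ((x + 1) / (4 * L))) * (D' - D)
      + δ / L - 2 / (x + 2) * i + l * (2 / (x + 2)) * C) =
      32 * L * (x * (x + 1) / 2) * f' + 32 * L * ((x + 1) * (x + 2) / 2) / N
      + 32 * L * (x + 1) / N + 64 * L ^ 2 * (D' - D) + 32 * ((x + 1) * (x + 2) / 2) * δ
      - 32 * L * (x + 1) * i + 32 * L * l * (x + 1) * C := by
    field_simp
    ring
  rw [e2] at m1
  -- This is α_k ≤ 1; the tolerances then contribute 32 + 32 + 4 = 68.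
  have h5 : 32 * L * (x + 1) / N ≤ 32 * L * ((x + 1) * (x + 2) / 2) / N := by
    gcongr
    nlinarith
  have e3 : (x + 1) * (x + 1 + 1) / 2 * (68 * L / N) =
      32 * L * ((x + 1) * (x + 2) / 2) / N + 32 * L * ((x + 1) * (x + 2) / 2) / N
      + (x + 1) * (x + 2) / 2 * (4 * L / N) := by ring
  rw [e3]
  have e4 : x + 1 + 1 = x + 2 := by ring
  rw [e4]
  linarith

/-- The weighted sum of the squared gradient mappings along a run. -/
lemma sum_norm_gradMap_sq_le {F : E → ℝ} {l : ℝ} {θs : E} (hΩc : IsClosed Ω) (hΩ : Convex ℝ Ω)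
    (hM : ∀ x ∈ Ω, ‖x‖ ≤ M) (hL : 0 < L) (hl : 0 ≤ l) (hF : SmoothOn F Ω L)
    (hFl : LowerSmoothOn F Ω l) (hθs : θs ∈ Ω) (hmin : IsMinOn F Ω θs) (hθ₀ : θ₀ ∈ Ω)
    (hrun : IsRun Ω G (stdParams L N) N θ₀ s a b) :
    ∑ k ∈ Finset.Icc 1 N, (Gam k)⁻¹ * ‖gradMap Ω (md G (stdParams L N) θ₀ s a b k)
          (Gbar G (stdParams L N) θ₀ s a b k) (1 / (2 * L))‖ ^ 2 ≤
    64 * L ^ 2 * ‖θ₀ - θs‖ ^ 2 + ∑ k ∈ Finset.Icc 1 N, ((Gam k)⁻¹ * (68 * L / N)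
        + 32 * L * l * (k : ℝ) * (‖θs‖ ^ 2 + 2 * M ^ 2)
        + 32 * (Gam k)⁻¹ * ‖Gbar G (stdParams L N) θ₀ s a b k
            - gradient F (md G (stdParams L N) θ₀ s a b k)‖ ^ 2
        - 32 * L * (k : ℝ) * inner ℝ (Gbar G (stdParams L N) θ₀ s a b k
            - gradient F (md G (stdParams L N) θ₀ s a b k))
            ((state G (stdParams L N) θ₀ s a b (k - 1)).1 - θs)) := by
  have key : ∀ n ≤ N, 32 * L * (Gam n)⁻¹ * (F (state G (stdParams L N) θ₀ s a b n).2 - F θs)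
      + 64 * L ^ 2 * ‖(state G (stdParams L N) θ₀ s a b n).1 - θs‖ ^ 2
      + ∑ k ∈ Finset.Icc 1 n, (Gam k)⁻¹ * ‖gradMap Ω (md G (stdParams L N) θ₀ s a b k)
          (Gbar G (stdParams L N) θ₀ s a b k) (1 / (2 * L))‖ ^ 2 ≤
    64 * L ^ 2 * ‖θ₀ - θs‖ ^ 2 + ∑ k ∈ Finset.Icc 1 n, ((Gam k)⁻¹ * (68 * L / N)
        + 32 * L * l * (k : ℝ) * (‖θs‖ ^ 2 + 2 * M ^ 2)
        + 32 * (Gam k)⁻¹ * ‖Gbar G (stdParams L N) θ₀ s a b k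
            - gradient F (md G (stdParams L N) θ₀ s a b k)‖ ^ 2
        - 32 * L * (k : ℝ) * inner ℝ (Gbar G (stdParams L N) θ₀ s a b k
            - gradient F (md G (stdParams L N) θ₀ s a b k))
            ((state G (stdParams L N) θ₀ s a b (k - 1)).1 - θs)) := by
    intro n
    induction n with
    -- As `(Gam 0)⁻¹ = 0`, the initial gap F(θ₀) - F(θ*) does not enter the bound.
    | zero => intro _; simp [inv_Gam, state]
    | succ n ih =>
      intro hn
      have h1 := ih (by omega)
      have h2 := potential_succ_le hΩc hΩ hM hL hl hF hFl hθs hθ₀ hrun (by omega : n < N)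
      rw [Finset.sum_Icc_succ_top (by omega), Finset.sum_Icc_succ_top (by omega),
        Nat.add_sub_cancel]
      linarith
  have h := key N le_rfl
  have h1 : 0 ≤ F (state G (stdParams L N) θ₀ s a b N).2 - F θs :=
    sub_nonneg.2 (hmin (state_mem hΩ hM hL hθ₀ hrun le_rfl).2)
  have h2 : 0 ≤ 32 * L * (Gam N)⁻¹ * (F (state G (stdParams L N) θ₀ s a b N).2 - F θs) :=
    mul_nonneg (mul_nonneg (by positivity) (inv_Gam_nonneg N)) h1
  have h3 : 0 ≤ 64 * L ^ 2 * ‖(state G (stdParams L N) θ₀ s a b N).1 - θs‖ ^ 2 := by positivity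
  linarith

end Run

/-! ### Measurability of the iterates. -/

section Measurability

/-- The first hitting index of a sequence of measurable sets is measurable. -/
lemma measurable_sInf_setOf {W : Type*} {m : MeasurableSpace W} {A : ℕ → Set W}
    (hA : ∀ t, MeasurableSet (A t)) : Measurable fun ω => sInf {t | ω ∈ A t} := by
  refine measurable_to_countable' fun n => ?_
  -- The second set accounts for the paths that never hit, where `sInf ∅ = 0`.
  have e : (fun ω => sInf {t | ω ∈ A t}) ⁻¹' {n} =
      (A n ∩ ⋂ r : Fin n, (A r)ᶜ) ∪ {ω | n = 0 ∧ ω ∈ ⋂ r, (A r)ᶜ} := by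
    ext ω
    simp only [Set.mem_preimage, Set.mem_singleton_iff, Set.mem_union, Set.mem_inter_iff,
      Set.mem_iInter, Set.mem_compl_iff, Set.mem_ofPred_eq]
    constructor
    · intro h
      by_cases hne : {t | ω ∈ A t}.Nonempty
      · left
        have hmem := Nat.sInf_mem hne
        rw [h] at hmem
        exact ⟨hmem, fun r => Nat.notMem_of_lt_sInf (s := {t | ω ∈ A t}) (h ▸ r.2)⟩
      · right
        rw [Set.not_nonempty_iff_eq_empty] at hne
        rw [hne, Nat.sInf_empty] at h
        exact ⟨h.symm, fun r hr => by
          have : r ∈ {t | ω ∈ A t} := hr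
          rw [hne] at this
          exact this⟩
    · rintro (⟨h1, h2⟩ | ⟨h1, h2⟩)
      · refine le_antisymm (Nat.sInf_le h1) (le_of_not_gt fun hlt => ?_)
        exact h2 ⟨_, hlt⟩ (Nat.sInf_mem (s := {t | ω ∈ A t}) ⟨n, h1⟩)
      · have : {t | ω ∈ A t} = ∅ := Set.eq_empty_iff_forall_notMem.2 h2
        rw [this, Nat.sInf_empty, h1]
  rw [e]
  refine MeasurableSet.union ((hA n).inter (MeasurableSet.iInter fun r => (hA r).compl)) ?_
  by_cases hn : n = 0
  · simp only [hn, true_and]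
    exact MeasurableSet.iInter fun r => (hA r).compl
  · simp [hn]

lemma measurable_eval_nat {W β : Type*} {m : MeasurableSpace W} [MeasurableSpace β]
    {f : ℕ → W → β} {T : W → ℕ} (hf : ∀ n, Measurable (f n)) (hT : Measurable T) :
    Measurable fun ω => f (T ω) ω :=
  (measurable_from_prod_countable_right (f := Function.uncurry f) hf).comp
    (hT.prodMk measurable_id)

variable {p : ℕ} {W S : Type*}

lemma measurable_condgIter {m : MeasurableSpace W} {l u : W → EuclideanSpace ℝ (Fin p)} {γ : ℝ}
    {v : ℕ → W → EuclideanSpace ℝ (Fin p)} (hl : Measurable l) (hu : Measurable u)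
    (hv : ∀ t, Measurable (v t)) (t : ℕ) :
    Measurable fun ω => condgIter (l ω) (u ω) γ (fun t => v t ω) t := by
  induction t with
  | zero => exact hu
  | succ t ih =>
    have hvt := hv t
    simp only [condgIter]
    fun_prop

lemma measurable_condg {m : MeasurableSpace W} {l u : W → EuclideanSpace ℝ (Fin p)} {γ η : ℝ}
    {v : ℕ → W → EuclideanSpace ℝ (Fin p)} (hl : Measurable l) (hu : Measurable u)
    (hv : ∀ t, Measurable (v t)) :
    Measurable fun ω => condg (l ω) (u ω) γ η (fun t => v t ω) := by
  have hgap : ∀ t, Measurable fun ω => condgGap (l ω) (u ω) γ (fun t => v t ω) t := by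
    intro t
    have h1 := measurable_condgIter (γ := γ) hl hu hv t
    have h2 := hv t
    simp only [condgGap, condgGrad]
    fun_prop
  exact measurable_eval_nat (measurable_condgIter hl hu hv)
    (measurable_sInf_setOf fun t => measurableSet_le (hgap t) measurable_const)

lemma measurable_batchGrad {m : MeasurableSpace W} [MeasurableSpace S]
    {G : EuclideanSpace ℝ (Fin p) → S → EuclideanSpace ℝ (Fin p)}
    (hG : Measurable (Function.uncurry G)) {n : ℕ} {x : W → EuclideanSpace ℝ (Fin p)}
    {ξ : ℕ → W → S} (hx : Measurable x) (hξ : ∀ i < n, Measurable (ξ i)) :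
    Measurable fun ω => batchGrad G n (x ω) (fun i => ξ i ω) := by
  simp only [batchGrad]
  have h : Measurable fun ω => ∑ i ∈ Finset.range n, G (x ω) (ξ i ω) :=
    Finset.measurable_fun_sum _ fun i hi =>
      hG.comp (hx.prodMk (hξ i (Finset.mem_range.1 hi)))
  exact h.const_smul (1 / (n : ℝ))

lemma measurable_midPoint {m : MeasurableSpace W} {α : ℝ}
    {z : W → EuclideanSpace ℝ (Fin p) × EuclideanSpace ℝ (Fin p)} (hz : Measurable z) :
    Measurable fun ω => midPoint α (z ω) := by
  simp only [midPoint]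
  fun_prop

/-- The σ-algebra `m` is a variable so that it can be any member of a filtration; only data of the
iterations up to n are needed. -/
lemma measurable_state {m : MeasurableSpace W} [MeasurableSpace S]
    {G : EuclideanSpace ℝ (Fin p) → S → EuclideanSpace ℝ (Fin p)}
    (hG : Measurable (Function.uncurry G)) {π : Params} {θ₀ : EuclideanSpace ℝ (Fin p)}
    {ξ : ℕ → ℕ → W → S} {a b : ℕ → ℕ → W → EuclideanSpace ℝ (Fin p)} (n : ℕ)
    (hξ : ∀ k ∈ Finset.Icc 1 n, ∀ i < π.m k, Measurable (ξ k i))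
    (ha : ∀ k ∈ Finset.Icc 1 n, ∀ t, Measurable (a k t))
    (hb : ∀ k ∈ Finset.Icc 1 n, ∀ t, Measurable (b k t)) :
    Measurable fun ω => state G π θ₀ (fun k i => ξ k i ω) (fun k t => a k t ω)
      (fun k t => b k t ω) n := by
  induction n with
  | zero => exact measurable_const
  | succ n ih =>
    have hsub : ∀ k ∈ Finset.Icc 1 n, k ∈ Finset.Icc 1 (n + 1) := fun k hk => by
      rw [Finset.mem_Icc] at hk ⊢; omega
    have htop : n + 1 ∈ Finset.Icc 1 (n + 1) := by rw [Finset.mem_Icc]; omega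
    have hz := ih (fun k hk => hξ k (hsub k hk)) (fun k hk => ha k (hsub k hk))
      (fun k hk => hb k (hsub k hk))
    have hx := measurable_midPoint (α := π.α (n + 1)) hz
    have hw := measurable_batchGrad hG hx (hξ _ htop)
    exact (measurable_condg hw hz.fst (ha _ htop)).prodMk (measurable_condg hw hx (hb _ htop))

lemma measurable_norm_gradMap_sq {m : MeasurableSpace W} {Ω : Set (EuclideanSpace ℝ (Fin p))}
    (hΩc : IsClosed Ω) (hΩ : Convex ℝ Ω) (hne : Ω.Nonempty) {γ : ℝ} (hγ : 0 < γ)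
    {x w : W → EuclideanSpace ℝ (Fin p)} (hx : Measurable x) (hw : Measurable w) :
    Measurable fun ω => ‖gradMap Ω (x ω) (w ω) γ‖ ^ 2 := by
  have hpsi := (continuous_psi hΩc hΩ hne hγ).measurable.comp (hx.prodMk hw)
  exact ((hx.sub hpsi).const_smul (1 / γ)).norm.pow_const 2

end Measurability

/-! ### Moments of mini-batch gradients. -/

section Batch

variable {p : ℕ} {S : Type*} [MeasurableSpace S] {P : Measure S} [IsProbabilityMeasure P]

/-- The second moment of a sum of independent copies of a centred random vector. -/
lemma integral_norm_sum_sq_pi {X : S → EuclideanSpace ℝ (Fin p)} (hX : Integrable X P)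
    (hX0 : ∫ s, X s ∂P = 0) (hX2 : Integrable (fun s => ‖X s‖ ^ 2) P) (m : ℕ) :
    Integrable (fun s : Fin m → S => ‖∑ i, X (s i)‖ ^ 2) (Measure.pi fun _ => P) ∧
      ∫ s : Fin m → S, ‖∑ i, X (s i)‖ ^ 2 ∂(Measure.pi fun _ => P) =
        m * ∫ s, ‖X s‖ ^ 2 ∂P := by
  have hL : MemLp X 2 P := (memLp_two_iff_integrable_sq_norm hX.aestronglyMeasurable).2 hX2
  -- The argument is coordinatewise, where additivity of scalar variances under independence
  -- applies.
  have hLc : ∀ c, MemLp (fun s => X s c) 2 P := fun c =>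
    (EuclideanSpace.proj (𝕜 := ℝ) c).comp_memLp' hL
  have hc0 : ∀ c, ∫ s, X s c ∂P = 0 := fun c => by
    have := (EuclideanSpace.proj (𝕜 := ℝ) c).integral_comp_comm hX
    rw [hX0, map_zero] at this
    exact this
  have hpi : ∀ c, ∀ i : Fin m,
      MemLp (fun s : Fin m → S => X (s i) c) 2 (Measure.pi fun _ => P) := fun c i =>
    (hLc c).comp_measurePreserving (measurePreserving_eval (fun _ : Fin m => P) i)
  have hsum : ∀ c, MemLp (fun s : Fin m → S => ∑ i, X (s i) c) 2 (Measure.pi fun _ => P) :=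
    fun c => memLp_finsetSum _ fun i _ => hpi c i
  have hmean : ∀ c, ∫ s : Fin m → S, ∑ i, X (s i) c ∂(Measure.pi fun _ => P) = 0 := fun c => by
    rw [integral_finsetSum _ fun i _ => (hpi c i).integrable one_le_two]
    refine Finset.sum_eq_zero fun i _ => ?_
    have := integral_comp_eval (μ := fun _ : Fin m => P) (i := i) (hLc c).aestronglyMeasurable
    rw [this, hc0]
  have hvar : ∀ c, ∫ s : Fin m → S, (∑ i, X (s i) c) ^ 2 ∂(Measure.pi fun _ => P) =
      m * ∫ s, X s c ^ 2 ∂P := fun c => by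
    have h1 := variance_sum_pi (μ := fun _ : Fin m => P) (X := fun _ s => X s c) fun _ => hLc c
    rw [Finset.sum_fn, variance_of_integral_eq_zero (hsum c).aemeasurable (hmean c)] at h1
    rw [h1, Finset.sum_const, Finset.card_univ, Fintype.card_fin, nsmul_eq_mul,
      variance_of_integral_eq_zero (hLc c).aemeasurable (hc0 c)]
  have hnorm : ∀ s : Fin m → S, ‖∑ i, X (s i)‖ ^ 2 = ∑ c, (∑ i, X (s i) c) ^ 2 := fun s => by
    rw [EuclideanSpace.real_norm_sq_eq]
    simp
  simp only [hnorm]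
  refine ⟨integrable_finsetSum _ fun c _ => (hsum c).integrable_sq, ?_⟩
  rw [integral_finsetSum _ fun c _ => (hsum c).integrable_sq]
  simp only [hvar, EuclideanSpace.real_norm_sq_eq]
  rw [integral_finsetSum _ fun c _ => (hLc c).integrable_sq, Finset.mul_sum]

/-- Mean and variance of a mini-batch gradient at a fixed point. -/
lemma batch_moments {F : EuclideanSpace ℝ (Fin p) → ℝ} {Ω : Set (EuclideanSpace ℝ (Fin p))}
    {σ : ℝ} {G : EuclideanSpace ℝ (Fin p) → S → EuclideanSpace ℝ (Fin p)}
    (hG : IsStochasticGradient P F Ω σ G) {θ : EuclideanSpace ℝ (Fin p)} (hθ : θ ∈ Ω)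
    {m : ℕ} (hm : 0 < m) :
    Integrable (fun s : Fin m → S => (1 / (m : ℝ)) • ∑ i, G θ (s i) - ∫ t, G θ t ∂P)
        (Measure.pi fun _ => P) ∧
      ∫ s : Fin m → S, ((1 / (m : ℝ)) • ∑ i, G θ (s i) - ∫ t, G θ t ∂P)
        ∂(Measure.pi fun _ => P) = 0 ∧
      Integrable (fun s : Fin m → S => ‖(1 / (m : ℝ)) • ∑ i, G θ (s i) - ∫ t, G θ t ∂P‖ ^ 2)
        (Measure.pi fun _ => P) ∧
      ∫ s : Fin m → S, ‖(1 / (m : ℝ)) • ∑ i, G θ (s i) - ∫ t, G θ t ∂P‖ ^ 2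
        ∂(Measure.pi fun _ => P) ≤ σ ^ 2 / m := by
  have hm' : (0 : ℝ) < m := by exact_mod_cast hm
  set T := ∫ t, G θ t ∂P with hT
  have hTF : T = gradient F θ := hG.unbiased θ hθ
  have hX : Integrable (fun s => G θ s - T) P := (hG.integrable θ hθ).sub (integrable_const T)
  have hX0 : ∫ s, (G θ s - T) ∂P = 0 := by
    rw [integral_sub (hG.integrable θ hθ) (integrable_const T), integral_const]
    simp [hT]
  have hX2 : Integrable (fun s => ‖G θ s - T‖ ^ 2) P := hTF ▸ hG.integrable_sq θ hθ
  obtain ⟨h1, h2⟩ := integral_norm_sum_sq_pi hX hX0 hX2 m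
  have e : ∀ s : Fin m → S, (1 / (m : ℝ)) • ∑ i, G θ (s i) - T =
      (1 / (m : ℝ)) • ∑ i, (G θ (s i) - T) := fun s => by
    rw [Finset.sum_sub_distrib, Finset.sum_const, Finset.card_univ, Fintype.card_fin, smul_sub,
      ← Nat.cast_smul_eq_nsmul ℝ, smul_smul, one_div_mul_cancel hm'.ne', one_smul]
  have hpi : ∀ i : Fin m, Integrable (fun s : Fin m → S => G θ (s i) - T)
      (Measure.pi fun _ => P) := fun i =>
    (measurePreserving_eval (fun _ : Fin m => P) i).integrable_comp_of_integrable hX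
  simp only [e]
  refine ⟨(integrable_finsetSum Finset.univ fun i _ => hpi i).fun_smul (1 / (m : ℝ)), ?_, ?_, ?_⟩
  · rw [integral_smul, integral_finsetSum _ fun i _ => hpi i]
    have : ∀ i : Fin m, ∫ s : Fin m → S, (G θ (s i) - T) ∂(Measure.pi fun _ => P) = 0 :=
      fun i => by
        rw [integral_comp_eval (μ := fun _ : Fin m => P) (i := i) (f := fun s => G θ s - T)
          hX.aestronglyMeasurable, hX0]
    simp [this]
  · simp only [norm_smul, mul_pow]
    exact h1.const_mul _
  · simp only [norm_smul, mul_pow]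
    rw [integral_const_mul, h2, Real.norm_eq_abs, sq_abs]
    have h3 : ∫ s, ‖G θ s - T‖ ^ 2 ∂P ≤ σ ^ 2 := hTF ▸ hG.variance_le θ hθ
    calc (1 / (m : ℝ)) ^ 2 * (m * ∫ s, ‖G θ s - T‖ ^ 2 ∂P)
        ≤ (1 / (m : ℝ)) ^ 2 * (m * σ ^ 2) := by gcongr
      _ = σ ^ 2 / m := by field_simp

/-- Mean and variance of the error of a mini-batch gradient at a random point that is independent
of the mini-batch. -/
lemma batch_error_moments {W : Type*} [mW : MeasurableSpace W] {μ : Measure W}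
    [IsProbabilityMeasure μ]
    {F : EuclideanSpace ℝ (Fin p) → ℝ} {Ω : Set (EuclideanSpace ℝ (Fin p))}
    {σ : ℝ} {G : EuclideanSpace ℝ (Fin p) → S → EuclideanSpace ℝ (Fin p)}
    (hG : IsStochasticGradient P F Ω σ G) (hΩ : MeasurableSet Ω) {m : ℕ} (hm : 0 < m)
    {x θ : W → EuclideanSpace ℝ (Fin p)} {B : W → Fin m → S} (hx : Measurable x)
    (hθ : Measurable θ) (hB : Measurable B) (hlaw : μ.map B = Measure.pi fun _ => P)
    (hind : IndepFun (fun ω => (x ω, θ ω)) B μ) (hxΩ : ∀ ω, x ω ∈ Ω) {C : ℝ}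
    (hθC : ∀ ω, ‖θ ω‖ ≤ C) :
    Integrable (fun ω => ‖(1 / (m : ℝ)) • ∑ i, G (x ω) (B ω i) - gradient F (x ω)‖ ^ 2) μ ∧
      ∫ ω, ‖(1 / (m : ℝ)) • ∑ i, G (x ω) (B ω i) - gradient F (x ω)‖ ^ 2 ∂μ ≤ σ ^ 2 / m ∧
      Integrable (fun ω => inner ℝ
        ((1 / (m : ℝ)) • ∑ i, G (x ω) (B ω i) - gradient F (x ω)) (θ ω)) μ ∧
      ∫ ω, inner ℝ ((1 / (m : ℝ)) • ∑ i, G (x ω) (B ω i) - gradient F (x ω)) (θ ω) ∂μ = 0 := by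
  set ν : Measure (Fin m → S) := Measure.pi fun _ => P with hν
  -- The integral of G(y, ·) is measurable in y on the whole space, so it replaces the gradient,
  -- whose formula is known only on Ω.
  have hTF : ∀ ω, gradient F (x ω) = ∫ t, G (x ω) t ∂P := fun ω =>
    (hG.unbiased _ (hxΩ ω)).symm
  simp only [hTF]
  have hT : Measurable fun y => ∫ t, G y t ∂P :=
    (hG.measurable.stronglyMeasurable.integral_prod_right').measurable
  let D : (EuclideanSpace ℝ (Fin p) × EuclideanSpace ℝ (Fin p)) × (Fin m → S) →
      EuclideanSpace ℝ (Fin p) := fun q =>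
    (1 / (m : ℝ)) • ∑ i, G q.1.1 (q.2 i) - ∫ t, G q.1.1 t ∂P
  have hD : Measurable D := by
    have h : Measurable fun q : (EuclideanSpace ℝ (Fin p) × EuclideanSpace ℝ (Fin p)) ×
        (Fin m → S) => ∑ i, G q.1.1 (q.2 i) :=
      Finset.measurable_fun_sum _ fun i _ => hG.measurable.comp
        (measurable_fst.fst.prodMk ((measurable_pi_apply i).comp measurable_snd))
    exact (h.const_smul (1 / (m : ℝ))).sub (hT.comp measurable_fst.fst)
  have hZ : Measurable fun ω => (x ω, θ ω) := hx.prodMk hθ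
  -- Independence makes the joint law a product, so by Fubini the point can be frozen and
  -- `batch_moments` applied.
  have hjoint : μ.map (fun ω => ((x ω, θ ω), B ω)) = (μ.map fun ω => (x ω, θ ω)).prod ν := by
    rw [(indepFun_iff_map_prod_eq_prod_map_map hZ.aemeasurable hB.aemeasurable).1 hind, hlaw]
  set ζ := μ.map fun ω => (x ω, θ ω) with hζ
  have : IsProbabilityMeasure ζ := Measure.isProbabilityMeasure_map hZ.aemeasurable
  have hpair : Measurable fun ω => ((x ω, θ ω), B ω) := hZ.prodMk hB
  have hae : ∀ᵐ z ∂ζ, z.1 ∈ Ω ∧ ‖z.2‖ ≤ C := by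
    rw [hζ, ae_map_iff hZ.aemeasurable]
    · exact ae_of_all _ fun ω => ⟨hxΩ ω, hθC ω⟩
    · exact (measurable_fst hΩ).inter (measurableSet_le measurable_snd.norm measurable_const)
  -- the square
  have hsq : Integrable (fun q => ‖D q‖ ^ 2) (ζ.prod ν) := by
    rw [integrable_prod_iff (hD.norm.pow_const 2).aestronglyMeasurable]
    refine ⟨?_, ?_⟩
    · filter_upwards [hae] with z hz
      exact (batch_moments hG hz.1 hm).2.2.1
    · refine Integrable.of_bound (C := σ ^ 2 / m) ?_ ?_
      · exact ((hD.norm.pow_const 2).norm.stronglyMeasurable.integral_prod_right'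
          ).aestronglyMeasurable
      · filter_upwards [hae] with z hz
        rw [Real.norm_of_nonneg (integral_nonneg fun _ => norm_nonneg _)]
        simp only [norm_pow, norm_norm]
        exact (batch_moments hG hz.1 hm).2.2.2
  have hin : Integrable (fun q => inner ℝ (D q) q.1.2) (ζ.prod ν) := by
    have hmeas : Measurable fun q => inner ℝ (D q) q.1.2 := hD.inner measurable_fst.snd
    refine Integrable.mono' ((hsq.add (integrable_const (C ^ 2)))) hmeas.aestronglyMeasurable ?_
    have : ∀ᵐ q ∂(ζ.prod ν), ‖q.1.2‖ ≤ C :=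
      Measure.quasiMeasurePreserving_fst.ae (hae.mono fun z hz => hz.2)
    filter_upwards [this] with q hq
    have h1 := norm_inner_le_norm (𝕜 := ℝ) (D q) q.1.2
    have h2 : ‖D q‖ * ‖q.1.2‖ ≤ ‖D q‖ * C := by gcongr
    simp only [Pi.add_apply]
    nlinarith [sq_nonneg (‖D q‖ - C), sq_nonneg ‖D q‖, sq_nonneg C]
  have hsq' := hsq
  have hin' := hin
  rw [← hjoint] at hsq' hin'
  refine ⟨hsq'.comp_measurable hpair, ?_, hin'.comp_measurable hpair, ?_⟩
  · have h1 := integral_map (μ := μ) hpair.aemeasurable (f := fun q => ‖D q‖ ^ 2)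
      hsq'.aestronglyMeasurable
    refine h1.symm.trans_le ?_
    rw [hjoint, integral_prod _ hsq]
    calc ∫ z, ∫ s, ‖D (z, s)‖ ^ 2 ∂ν ∂ζ ≤ ∫ _, σ ^ 2 / m ∂ζ := by
          refine integral_mono_ae hsq.integral_prod_left (integrable_const _) ?_
          filter_upwards [hae] with z hz
          exact (batch_moments hG hz.1 hm).2.2.2
      _ = σ ^ 2 / m := by simp
  · have h1 := integral_map (μ := μ) hpair.aemeasurable (f := fun q => inner ℝ (D q) q.1.2)
      hin'.aestronglyMeasurable
    refine h1.symm.trans ?_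
    rw [hjoint, integral_prod _ hin]
    refine integral_eq_zero_of_ae ?_
    filter_upwards [hae] with z hz
    obtain ⟨h2, h3, -, -⟩ := batch_moments hG hz.1 hm
    have h4 := integral_inner (𝕜 := ℝ) h2 z.2
    rw [h3, inner_zero_right] at h4
    simp only [Pi.zero_apply]
    rw [← h4]
    exact integral_congr_ae (ae_of_all _ fun s => real_inner_comm _ _)

end Batch

/-! ### Sums of the weights and comparison of constants. -/

section Sums

lemma sum_Icc_cast (N : ℕ) : ∑ k ∈ Finset.Icc 1 N, (k : ℝ) = (N : ℝ) * (N + 1) / 2 := by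
  induction N with
  | zero => simp
  | succ n ih => rw [Finset.sum_Icc_succ_top (by omega), ih]; push_cast; ring

lemma sum_Icc_inv_Gam (N : ℕ) :
    ∑ k ∈ Finset.Icc 1 N, (Gam k)⁻¹ = (N : ℝ) * (N + 1) * (N + 2) / 6 := by
  induction N with
  | zero => simp
  | succ n ih => rw [Finset.sum_Icc_succ_top (by omega), ih, inv_Gam]; push_cast; ring

lemma sum_Icc_inv_Gam_div (N : ℕ) :
    ∑ k ∈ Finset.Icc 1 N, (Gam k)⁻¹ / k = (N : ℝ) * (N + 3) / 4 := by
  induction N with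
  | zero => simp
  | succ n ih =>
    rw [Finset.sum_Icc_succ_top (by omega), ih, inv_Gam]
    push_cast
    field_simp
    ring

/-- The final comparison of constants. -/
lemma weighted_bound_le {L l σ C D : ℝ} {N : ℕ} (hL : 0 < L) (hl : 0 ≤ l) (hC : 0 ≤ C)
    (hD : 0 ≤ D) (hN : 1 ≤ N) :
    (64 * L ^ 2 * D + ∑ k ∈ Finset.Icc 1 N, ((Gam k)⁻¹ * (68 * L / N)
        + 32 * L * l * (k : ℝ) * C + 32 * (Gam k)⁻¹ * (σ ^ 2 / k)))
        / ∑ k ∈ Finset.Icc 1 N, (Gam k)⁻¹ ≤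
      192 * L * (4 * L * D / ((N : ℝ) ^ 2 * ((N : ℝ) + 1)) + l / N * C + 1 / N
        + 3 * σ ^ 2 / (2 * L * N)) := by
  have e : ∑ k ∈ Finset.Icc 1 N, ((Gam k)⁻¹ * (68 * L / N)
        + 32 * L * l * (k : ℝ) * C + 32 * (Gam k)⁻¹ * (σ ^ 2 / k)) =
      (∑ k ∈ Finset.Icc 1 N, (Gam k)⁻¹) * (68 * L / N)
        + 32 * L * l * C * (∑ k ∈ Finset.Icc 1 N, (k : ℝ))
        + 32 * σ ^ 2 * ∑ k ∈ Finset.Icc 1 N, (Gam k)⁻¹ / k := by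
    rw [Finset.sum_add_distrib, Finset.sum_add_distrib, ← Finset.sum_mul, Finset.mul_sum,
      Finset.mul_sum]
    congr 1
    · congr 1
      exact Finset.sum_congr rfl fun k _ => by ring
    · exact Finset.sum_congr rfl fun k _ => by ring
  rw [e, sum_Icc_inv_Gam, sum_Icc_cast, sum_Icc_inv_Gam_div]
  have hx : (1 : ℝ) ≤ N := by exact_mod_cast hN
  generalize (N : ℝ) = x at *
  have hx0 : 0 < x := by linarith
  rw [div_le_iff₀ (by positivity)]
  -- After multiplication by the total weight N(N+1)(N+2)/6, the four terms are compared separately.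
  have h1 : 64 * L ^ 2 * D ≤
      192 * L * (4 * L * D / (x ^ 2 * (x + 1))) * (x * (x + 1) * (x + 2) / 6) := by
    have : 192 * L * (4 * L * D / (x ^ 2 * (x + 1))) * (x * (x + 1) * (x + 2) / 6) =
        128 * L ^ 2 * D * ((x + 2) / x) := by field_simp; ring
    rw [this]
    have h2 : 1 ≤ (x + 2) / x := by rw [le_div_iff₀ hx0]; linarith
    have h3 : 0 ≤ L ^ 2 * D := by positivity
    nlinarith
  have h2 : x * (x + 1) * (x + 2) / 6 * (68 * L / x) ≤
      192 * L * (1 / x) * (x * (x + 1) * (x + 2) / 6) := by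
    have e1 : x * (x + 1) * (x + 2) / 6 * (68 * L / x) = 68 * (L * ((x + 1) * (x + 2) / 6)) := by
      field_simp
    have e2 : 192 * L * (1 / x) * (x * (x + 1) * (x + 2) / 6) =
      192 * (L * ((x + 1) * (x + 2) / 6)) := by field_simp
    rw [e1, e2]
    gcongr
    norm_num
  have h3 : 32 * L * l * C * (x * (x + 1) / 2) ≤
      192 * L * (l / x * C) * (x * (x + 1) * (x + 2) / 6) := by
    have e1 : 192 * L * (l / x * C) * (x * (x + 1) * (x + 2) / 6) =
      32 * L * l * C * ((x + 1) * (x + 2)) := by field_simp; ring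
    rw [e1]
    gcongr
    nlinarith
  have h4 : 32 * σ ^ 2 * (x * (x + 3) / 4) ≤
      192 * L * (3 * σ ^ 2 / (2 * L * x)) * (x * (x + 1) * (x + 2) / 6) := by
    have e1 : 192 * L * (3 * σ ^ 2 / (2 * L * x)) * (x * (x + 1) * (x + 2) / 6) =
      32 * σ ^ 2 * (3 / 2 * ((x + 1) * (x + 2))) := by field_simp; ring
    rw [e1]
    gcongr
    nlinarith
  linarith

end Sums

/-! ### Adaptedness to the filtration. -/

section Adapted

variable {p : ℕ} {S W : Type*} [MeasurableSpace S] {P : Measure S} [mW : MeasurableSpace W]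
  {μ : Measure W} {Ω : Set (EuclideanSpace ℝ (Fin p))} {L : ℝ}
  {G : EuclideanSpace ℝ (Fin p) → S → EuclideanSpace ℝ (Fin p)} {N : ℕ}
  {θ₀ : EuclideanSpace ℝ (Fin p)} {ℱ : Filtration ℕ mW} {ξ : ℕ → ℕ → W → S}
  {a b : ℕ → ℕ → W → EuclideanSpace ℝ (Fin p)}

lemma measurable_state_filtration (hG : Measurable (Function.uncurry G))
    (hξ : IsSampling μ P ℱ (stdParams L N).m N ξ)
    (ha : ∀ k ∈ Finset.Icc 1 N, ∀ t, Measurable[ℱ k] (a k t))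
    (hb : ∀ k ∈ Finset.Icc 1 N, ∀ t, Measurable[ℱ k] (b k t)) {n : ℕ} (hn : n ≤ N) :
    Measurable[ℱ n] fun ω => state G (stdParams L N) θ₀ (fun k i => ξ k i ω)
      (fun k t => a k t ω) (fun k t => b k t ω) n := by
  have hk : ∀ k ∈ Finset.Icc 1 n, k ∈ Finset.Icc 1 N ∧ k ≤ n := fun k hk => by
    rw [Finset.mem_Icc] at hk ⊢; omega
  exact measurable_state hG n
    (fun k h i hi => (hξ.adapted k (hk k h).1 i hi).mono (ℱ.mono (hk k h).2) le_rfl)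
    (fun k h t => (ha k (hk k h).1 t).mono (ℱ.mono (hk k h).2) le_rfl)
    (fun k h t => (hb k (hk k h).1 t).mono (ℱ.mono (hk k h).2) le_rfl)

/-- Measurability of the point and of the mini-batch gradient of an iteration. -/
lemma measurable_md_Gbar (hG : Measurable (Function.uncurry G))
    (hξ : IsSampling μ P ℱ (stdParams L N).m N ξ)
    (ha : ∀ k ∈ Finset.Icc 1 N, ∀ t, Measurable[ℱ k] (a k t))
    (hb : ∀ k ∈ Finset.Icc 1 N, ∀ t, Measurable[ℱ k] (b k t)) {n : ℕ} (hn : n < N) :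
    (Measurable[ℱ n] fun ω => md G (stdParams L N) θ₀ (fun k i => ξ k i ω)
      (fun k t => a k t ω) (fun k t => b k t ω) (n + 1)) ∧
    Measurable[ℱ (n + 1)] fun ω => Gbar G (stdParams L N) θ₀ (fun k i => ξ k i ω)
      (fun k t => a k t ω) (fun k t => b k t ω) (n + 1) := by
  have hx : Measurable[ℱ n] fun ω => md G (stdParams L N) θ₀ (fun k i => ξ k i ω)
      (fun k t => a k t ω) (fun k t => b k t ω) (n + 1) :=
    measurable_midPoint (measurable_state_filtration hG hξ ha hb hn.le)
  refine ⟨hx, ?_⟩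
  exact measurable_batchGrad hG (hx.mono (ℱ.mono n.le_succ) le_rfl)
    (hξ.adapted (n + 1) (Finset.mem_Icc.2 ⟨by omega, by omega⟩))

/-- The gradient mapping along the method is adapted and has bounded norm. -/
lemma gradMap_measurable_and_integrable [IsFiniteMeasure μ] {M : ℝ}
    (hΩc : IsClosed Ω) (hΩ : Convex ℝ Ω)
    (hM : ∀ x ∈ Ω, ‖x‖ ≤ M) (hL : 0 < L) (hG : Measurable (Function.uncurry G)) (hθ₀ : θ₀ ∈ Ω)
    (hξ : IsSampling μ P ℱ (stdParams L N).m N ξ)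
    (ha : ∀ k ∈ Finset.Icc 1 N, ∀ t, Measurable[ℱ k] (a k t))
    (hb : ∀ k ∈ Finset.Icc 1 N, ∀ t, Measurable[ℱ k] (b k t))
    (hrun : ∀ ω, IsRun Ω G (stdParams L N) N θ₀
      (fun k i => ξ k i ω) (fun k t => a k t ω) (fun k t => b k t ω))
    {k : ℕ} (hk : k ∈ Finset.Icc 1 N) :
    (Measurable[ℱ N] fun ω => ‖gradMap Ω (md G (stdParams L N) θ₀ (fun k i => ξ k i ω)
        (fun k t => a k t ω) (fun k t => b k t ω) k) (Gbar G (stdParams L N) θ₀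
        (fun k i => ξ k i ω) (fun k t => a k t ω) (fun k t => b k t ω) k)
        (1 / (2 * L))‖ ^ 2) ∧
      Integrable (fun ω => ‖gradMap Ω (md G (stdParams L N) θ₀ (fun k i => ξ k i ω)
        (fun k t => a k t ω) (fun k t => b k t ω) k) (Gbar G (stdParams L N) θ₀
        (fun k i => ξ k i ω) (fun k t => a k t ω) (fun k t => b k t ω) k)
        (1 / (2 * L))‖ ^ 2) μ := by
  obtain ⟨n, rfl⟩ : ∃ n, k = n + 1 := ⟨k - 1, by rw [Finset.mem_Icc] at hk; omega⟩
  have hn : n < N := by rw [Finset.mem_Icc] at hk; omega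
  have hγ : 0 < 1 / (2 * L) := by positivity
  obtain ⟨hx, hw⟩ := measurable_md_Gbar (θ₀ := θ₀) hG hξ ha hb hn
  replace hx := hx.mono (ℱ.mono hn.le) le_rfl
  replace hw := hw.mono (ℱ.mono hn) le_rfl
  have hmeas := measurable_norm_gradMap_sq hΩc hΩ ⟨θ₀, hθ₀⟩ hγ hx hw
  refine ⟨hmeas, Integrable.of_bound (hmeas.mono (ℱ.le N) le_rfl).aestronglyMeasurable
    ((1 / (1 / (2 * L)) * (M + M)) ^ 2) (ae_of_all _ fun ω => ?_)⟩
  rw [norm_pow, norm_norm, gradMap, norm_smul, Real.norm_of_nonneg (by positivity)]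
  gcongr
  refine (norm_sub_le _ _).trans (add_le_add (hM _ ?_) (hM _ ?_))
  · exact md_succ_mem hΩ hM hL hθ₀ (hrun ω) hn.le
  · exact (psi_isProx hΩc hΩ ⟨θ₀, hθ₀⟩ _ _ hγ).1

end Adapted

/-! ### Averaging over the random index and over the samples. -/

section Expectation

variable {p : ℕ} {S W : Type*} [MeasurableSpace S] {P : Measure S} [IsProbabilityMeasure P]
  [mW : MeasurableSpace W] {μ : Measure W} [IsProbabilityMeasure μ]

/-- Expectation of a process evaluated at an independent random index. -/
lemma integral_stoppingIndex {ℱ : Filtration ℕ mW} {N : ℕ} (hN : 1 ≤ N) {R : W → ℕ}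
    (hR : IsStoppingIndex μ ℱ N R) {g : ℕ → W → ℝ}
    (hg : ∀ k ∈ Finset.Icc 1 N, Measurable[ℱ N] (g k))
    (hgi : ∀ k ∈ Finset.Icc 1 N, Integrable (g k) μ) :
    Integrable (fun ω => g (R ω) ω) μ ∧
      ∫ ω, g (R ω) ω ∂μ =
        (∑ k ∈ Finset.Icc 1 N, (Gam k)⁻¹ * ∫ ω, g k ω ∂μ) / ∑ k ∈ Finset.Icc 1 N, (Gam k)⁻¹ := by
  have hset : ∀ k, MeasurableSet {ω | R ω = k} := fun k =>
    hR.measurable (measurableSet_singleton k)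
  have hS : (∑ k ∈ Finset.Icc 1 N, (Gam k)⁻¹) ≠ 0 := by
    have : (0 : ℝ) < N := by exact_mod_cast hN
    rw [sum_Icc_inv_Gam]
    positivity
  -- The prescribed probabilities sum to one, so R almost surely takes no value outside {1, …, N}.
  have hone : μ.real {ω | R ω ∈ Finset.Icc 1 N} = 1 := by
    have hU : {ω | R ω ∈ Finset.Icc 1 N} = ⋃ k ∈ Finset.Icc 1 N, {ω | R ω = k} := by
      ext ω; simp
    rw [hU, measureReal_biUnion_finset]
    · rw [Finset.sum_congr rfl hR.prob, ← Finset.sum_div, div_self hS]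
    · intro i _ j _ hij
      rw [Function.onFun, Set.disjoint_left]
      intro ω hi hj
      exact hij (Eq.trans (Eq.symm hi) hj)
    · exact fun k _ => hset k
  have hRae : ∀ᵐ ω ∂μ, R ω ∈ Finset.Icc 1 N := by
    have hm : MeasurableSet {ω | R ω ∈ Finset.Icc 1 N} :=
      hR.measurable (Finset.Icc 1 N).measurableSet
    have h1 : μ {ω | R ω ∈ Finset.Icc 1 N} = 1 := by
      rw [← ENNReal.toReal_eq_one_iff]; exact hone
    exact (prob_compl_eq_zero_iff hm).2 h1
  have hae : (fun ω => g (R ω) ω) =ᵐ[μ]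
      fun ω => ∑ k ∈ Finset.Icc 1 N, {ω | R ω = k}.indicator (fun _ => (1 : ℝ)) ω * g k ω := by
    filter_upwards [hRae] with ω hω
    rw [Finset.sum_eq_single_of_mem (R ω) hω]
    · simp
    · intro k _ hk
      have : ω ∉ {ω | R ω = k} := fun h => hk (Eq.symm h)
      rw [Set.indicator_of_notMem this, zero_mul]
  have hind : ∀ k ∈ Finset.Icc 1 N,
      IndepFun ({ω | R ω = k}.indicator fun _ => (1 : ℝ)) (g k) μ := by
    intro k hk
    refine indep_of_indep_of_le_left (indep_of_indep_of_le_right hR.indep (hg k hk).comap_le) ?_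
    have : ({ω | R ω = k}.indicator fun _ => (1 : ℝ)) =
        (({k} : Set ℕ).indicator fun _ => (1 : ℝ)) ∘ R := by
      ext ω; rfl
    rw [this, ← MeasurableSpace.comap_comp]
    exact MeasurableSpace.comap_mono (Measurable.of_discrete.comap_le)
  have hint1 : ∀ k, Integrable ({ω | R ω = k}.indicator fun _ => (1 : ℝ)) μ := fun k =>
    (integrable_const 1).indicator (hset k)
  have hint : ∀ k ∈ Finset.Icc 1 N, Integrable
      (fun ω => {ω | R ω = k}.indicator (fun _ => (1 : ℝ)) ω * g k ω) μ := fun k hk =>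
    (hind k hk).integrable_mul (hint1 k) (hgi k hk)
  refine ⟨(integrable_finsetSum _ hint).congr hae.symm, ?_⟩
  rw [integral_congr_ae hae, integral_finsetSum _ hint, Finset.sum_div]
  refine Finset.sum_congr rfl fun k hk => ?_
  rw [(hind k hk).integral_fun_mul_eq_mul_integral (hint1 k).aestronglyMeasurable
    (hgi k hk).aestronglyMeasurable, integral_indicator_const _ (hset k), hR.prob k hk]
  simp only [smul_eq_mul, mul_one]
  ring

variable {Ω : Set (EuclideanSpace ℝ (Fin p))} {M L : ℝ}
  {F : EuclideanSpace ℝ (Fin p) → ℝ} {σ : ℝ}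
  {G : EuclideanSpace ℝ (Fin p) → S → EuclideanSpace ℝ (Fin p)} {N : ℕ}
  {θ₀ : EuclideanSpace ℝ (Fin p)} {ℱ : Filtration ℕ mW} {ξ : ℕ → ℕ → W → S}
  {a b : ℕ → ℕ → W → EuclideanSpace ℝ (Fin p)}

/-- Mean and variance of the gradient error in one iteration. -/
lemma gradient_error_moments (hΩc : IsClosed Ω) (hΩ : Convex ℝ Ω) (hM : ∀ x ∈ Ω, ‖x‖ ≤ M)
    (hL : 0 < L) (hG : IsStochasticGradient P F Ω σ G) (hθ₀ : θ₀ ∈ Ω)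
    (hξ : IsSampling μ P ℱ (stdParams L N).m N ξ)
    (ha : ∀ k ∈ Finset.Icc 1 N, ∀ t, Measurable[ℱ k] (a k t))
    (hb : ∀ k ∈ Finset.Icc 1 N, ∀ t, Measurable[ℱ k] (b k t))
    (hrun : ∀ ω, IsRun Ω G (stdParams L N) N θ₀
      (fun k i => ξ k i ω) (fun k t => a k t ω) (fun k t => b k t ω))
    (θs : EuclideanSpace ℝ (Fin p)) {k : ℕ} (hk : k ∈ Finset.Icc 1 N) :
    Integrable (fun ω => ‖Gbar G (stdParams L N) θ₀ (fun k i => ξ k i ω)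
        (fun k t => a k t ω) (fun k t => b k t ω) k - gradient F (md G (stdParams L N) θ₀
        (fun k i => ξ k i ω) (fun k t => a k t ω) (fun k t => b k t ω) k)‖ ^ 2) μ ∧
      ∫ ω, ‖Gbar G (stdParams L N) θ₀ (fun k i => ξ k i ω)
        (fun k t => a k t ω) (fun k t => b k t ω) k - gradient F (md G (stdParams L N) θ₀
        (fun k i => ξ k i ω) (fun k t => a k t ω) (fun k t => b k t ω) k)‖ ^ 2 ∂μ ≤ σ ^ 2 / k ∧
      Integrable (fun ω => inner ℝ (Gbar G (stdParams L N) θ₀ (fun k i => ξ k i ω)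
        (fun k t => a k t ω) (fun k t => b k t ω) k - gradient F (md G (stdParams L N) θ₀
        (fun k i => ξ k i ω) (fun k t => a k t ω) (fun k t => b k t ω) k))
        ((state G (stdParams L N) θ₀ (fun k i => ξ k i ω)
          (fun k t => a k t ω) (fun k t => b k t ω) (k - 1)).1 - θs)) μ ∧
      ∫ ω, inner ℝ (Gbar G (stdParams L N) θ₀ (fun k i => ξ k i ω)
        (fun k t => a k t ω) (fun k t => b k t ω) k - gradient F (md G (stdParams L N) θ₀
        (fun k i => ξ k i ω) (fun k t => a k t ω) (fun k t => b k t ω) k))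
        ((state G (stdParams L N) θ₀ (fun k i => ξ k i ω)
          (fun k t => a k t ω) (fun k t => b k t ω) (k - 1)).1 - θs) ∂μ = 0 := by
  obtain ⟨n, rfl⟩ : ∃ n, k = n + 1 := ⟨k - 1, by rw [Finset.mem_Icc] at hk; omega⟩
  have hn : n < N := by rw [Finset.mem_Icc] at hk; omega
  have hx := (measurable_md_Gbar (θ₀ := θ₀) hG.measurable hξ ha hb hn).1
  have hθ : Measurable[ℱ n] fun ω => (state G (stdParams L N) θ₀ (fun k i => ξ k i ω)
      (fun k t => a k t ω) (fun k t => b k t ω) n).1 - θs :=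
    (measurable_state_filtration hG.measurable hξ ha hb hn.le).fst.sub_const θs
  have hξm : ∀ i : Fin (n + 1), Measurable (ξ (n + 1) i) := fun i =>
    (hξ.adapted (n + 1) hk i i.2).mono (ℱ.le _) le_rfl
  have hlaw : μ.map (fun ω (i : Fin (n + 1)) => ξ (n + 1) i ω) = Measure.pi fun _ => P := by
    have hi : iIndepFun (fun i : Fin (n + 1) => ξ (n + 1) i) μ := hξ.indep_batch (n + 1) hk
    rw [(iIndepFun_iff_map_fun_eq_pi_map fun i => (hξm i).aemeasurable).1 hi]
    congr 1
    exact funext fun i => hξ.law (n + 1) hk i i.2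
  have hind : IndepFun (fun ω => (md G (stdParams L N) θ₀ (fun k i => ξ k i ω)
      (fun k t => a k t ω) (fun k t => b k t ω) (n + 1),
      (state G (stdParams L N) θ₀ (fun k i => ξ k i ω)
      (fun k t => a k t ω) (fun k t => b k t ω) n).1 - θs))
      -- With k = n + 1, the point θ_k^md and θ_{k-1} are both known at time n, before the k-th
      -- batch is drawn.
      (fun ω (i : Fin (n + 1)) => ξ (n + 1) i ω) μ :=
    indep_of_indep_of_le_left (hξ.indep_past (n + 1) hk).symm (hx.prodMk hθ).comap_le
  have h := batch_error_moments hG hΩc.measurableSet n.succ_pos (hx.mono (ℱ.le n) le_rfl)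
    (hθ.mono (ℱ.le n) le_rfl) (measurable_pi_lambda _ hξm) hlaw hind
    (fun ω => md_succ_mem hΩ hM hL hθ₀ (hrun ω) hn.le)
    (C := M + ‖θs‖) (fun ω => (norm_sub_le _ _).trans
      (add_le_add (hM _ (state_mem hΩ hM hL hθ₀ (hrun ω) hn.le).1) le_rfl))
  have e : ∀ ω, Gbar G (stdParams L N) θ₀ (fun k i => ξ k i ω)
      (fun k t => a k t ω) (fun k t => b k t ω) (n + 1) =
      (1 / ((n + 1 : ℕ) : ℝ)) • ∑ i : Fin (n + 1), G (md G (stdParams L N) θ₀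
        (fun k i => ξ k i ω) (fun k t => a k t ω) (fun k t => b k t ω) (n + 1))
        (ξ (n + 1) i ω) := fun ω => by
    rw [Gbar, batchGrad, Finset.sum_range]
    rfl
  simp only [e]
  exact h

end Expectation

end NCGS

/-! ### The bound in expectation. -/

theorem theorem2 {p : ℕ}
    -- the feasible set, the bound on the prox-mapping and the objective
    (Ω : Set (EuclideanSpace ℝ (Fin p))) (hΩ_closed : IsClosed Ω) (hΩ_convex : Convex ℝ Ω)
    (M : ℝ) (hM : ∀ γ > 0, ∀ x ∈ Ω, ∀ w : EuclideanSpace ℝ (Fin p), ‖NCGS.psi Ω x w γ‖ ≤ M)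
    (F : EuclideanSpace ℝ (Fin p) → ℝ) (L l : ℝ) (hL : 0 < L) (hl : 0 ≤ l)
    (hF : NCGS.SmoothOn F Ω L) (hF_lower : NCGS.LowerSmoothOn F Ω l)
    (θstar : EuclideanSpace ℝ (Fin p)) (hθstar : θstar ∈ Ω) (hmin : IsMinOn F Ω θstar)
    -- the stochastic gradients
    {S : Type*} [MeasurableSpace S] (P : Measure S) [IsProbabilityMeasure P]
    (σ : ℝ) (G : EuclideanSpace ℝ (Fin p) → S → EuclideanSpace ℝ (Fin p))
    (hG : NCGS.IsStochasticGradient P F Ω σ G)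
    -- the starting point, the samples, the answers of the linear oracle and the stopping index
    (N : ℕ) (hN : 1 ≤ N) (θ₀ : EuclideanSpace ℝ (Fin p)) (hθ₀ : θ₀ ∈ Ω)
    {W : Type*} [mW : MeasurableSpace W] (μ : Measure W) [IsProbabilityMeasure μ]
    (ℱ : Filtration ℕ mW) (ξ : ℕ → ℕ → W → S)
    (hξ : NCGS.IsSampling μ P ℱ (NCGS.stdParams L N).m N ξ)
    (a b : ℕ → ℕ → W → EuclideanSpace ℝ (Fin p))
    (ha : ∀ k ∈ Finset.Icc 1 N, ∀ t, Measurable[ℱ k] (a k t))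
    (hb : ∀ k ∈ Finset.Icc 1 N, ∀ t, Measurable[ℱ k] (b k t))
    (hrun : ∀ ω, NCGS.IsRun Ω G (NCGS.stdParams L N) N θ₀
      (fun k i => ξ k i ω) (fun k t => a k t ω) (fun k t => b k t ω))
    (R : W → ℕ) (hR : NCGS.IsStoppingIndex μ ℱ N R) :
    Integrable (fun ω => ‖NCGS.gradMap Ω
        (NCGS.md G (NCGS.stdParams L N) θ₀
          (fun k i => ξ k i ω) (fun k t => a k t ω) (fun k t => b k t ω) (R ω))
        (NCGS.Gbar G (NCGS.stdParams L N) θ₀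
          (fun k i => ξ k i ω) (fun k t => a k t ω) (fun k t => b k t ω) (R ω))
        ((NCGS.stdParams L N).β (R ω))‖ ^ 2) μ ∧
    ∫ ω, ‖NCGS.gradMap Ω
        (NCGS.md G (NCGS.stdParams L N) θ₀
          (fun k i => ξ k i ω) (fun k t => a k t ω) (fun k t => b k t ω) (R ω))
        (NCGS.Gbar G (NCGS.stdParams L N) θ₀
          (fun k i => ξ k i ω) (fun k t => a k t ω) (fun k t => b k t ω) (R ω))
        ((NCGS.stdParams L N).β (R ω))‖ ^ 2 ∂μ
      ≤ 192 * L * (4 * L * ‖θ₀ - θstar‖ ^ 2 / ((N : ℝ) ^ 2 * ((N : ℝ) + 1))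
          + l / N * (‖θstar‖ ^ 2 + 2 * M ^ 2) + 1 / N + 3 * σ ^ 2 / (2 * L * N)) := by
  have hbd : ∀ x ∈ Ω, ‖x‖ ≤ M := fun x hx => by
    have := hM 1 one_pos x hx 0
    rwa [NCGS.psi_zero hΩ_closed hΩ_convex hx] at this
  have hgrad := fun k (hk : k ∈ Finset.Icc 1 N) => NCGS.gradMap_measurable_and_integrable
    hΩ_closed hΩ_convex hbd hL hG.measurable hθ₀ hξ ha hb hrun hk
  have hmom := fun k (hk : k ∈ Finset.Icc 1 N) => NCGS.gradient_error_moments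
    hΩ_closed hΩ_convex hbd hL hG hθ₀ hξ ha hb hrun θstar hk
  obtain ⟨hint, heq⟩ := NCGS.integral_stoppingIndex hN hR (fun k hk => (hgrad k hk).1)
    (fun k hk => (hgrad k hk).2)
  refine ⟨hint, heq.trans_le ?_⟩
  refine le_trans ?_ (NCGS.weighted_bound_le (C := ‖θstar‖ ^ 2 + 2 * M ^ 2) hL hl (by positivity)
    (sq_nonneg ‖θ₀ - θstar‖) hN)
  refine div_le_div_of_nonneg_right ?_ (Finset.sum_nonneg fun k _ => NCGS.inv_Gam_nonneg k)
  simp only [← integral_const_mul]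
  rw [← integral_finsetSum _ fun k hk => (hgrad k hk).2.const_mul _]
  have hterm := fun k (hk : k ∈ Finset.Icc 1 N) =>
    ((integrable_const ((NCGS.Gam k)⁻¹ * (68 * L / N)
      + 32 * L * l * (k : ℝ) * (‖θstar‖ ^ 2 + 2 * M ^ 2)) (μ := μ)).add
      ((hmom k hk).1.const_mul (32 * (NCGS.Gam k)⁻¹))).sub
      ((hmom k hk).2.2.1.const_mul (32 * L * (k : ℝ)))
  -- The summed inequality holds for every ω, so it can be integrated directly.
  refine (integral_mono (integrable_finsetSum _ fun k hk => (hgrad k hk).2.const_mul _)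
    ((integrable_const _).add (integrable_finsetSum _ hterm))
    fun ω => NCGS.sum_norm_gradMap_sq_le hΩ_closed hΩ_convex hbd hL hl hF hF_lower hθstar hmin
      hθ₀ (hrun ω)).trans ?_
  rw [integral_add' (integrable_const _) (integrable_finsetSum _ hterm),
    integral_finsetSum _ hterm, integral_const, probReal_univ, one_smul]
  gcongr with k hk
  -- The inner product with the gradient error has mean zero, and only the variance bound σ²/k
  -- remains to be inserted.
  rw [integral_sub' ((integrable_const _).add ((hmom k hk).1.const_mul _))
    ((hmom k hk).2.2.1.const_mul _), integral_add' (integrable_const _)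
    ((hmom k hk).1.const_mul _), integral_const, probReal_univ, one_smul, integral_const_mul,
    integral_const_mul, (hmom k hk).2.2.2, mul_zero, sub_zero]
  have := NCGS.inv_Gam_nonneg k
  gcongr
  exact (hmom k hk).2.1
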